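/- **Theorem 2.4.** Fix a real number $\alpha>0$. On the doubly slit plane $\mathcal H=\mathbb C\setminus\big((-\infty,-\tfrac{\pi}{2})\cup(\tfrac{\pi}{2},\infty)\big)$ put $$F(x)=\int_{-\pi/2}^{x}(\cos y)^{\alpha}\,dy ,$$ the integral being taken along any contour in $\mathcal H$ from $-\pi/2$ to $x$, where powers of the cosine are $(\cos y)^{s}=e^{s\operatorname{Log}\cos y}$ with the branch equal to $1$ at $y=0$. For $\nu,\kappa\in\mathbb C$ with $\nu-\kappa\in\{0,1,2,\dots\}$ define $$A[\nu,\kappa]=\frac{\alpha^{\nu-\kappa+1}}{(\nu-\kappa)!}\cdot\frac{\Gamma(\nu+1)}{2\pi i}\int_{-i\infty}^{+i\infty}(\cos x)^{-\alpha\nu}F(x)^{\nu-\kappa}\,dx\qquad(\operatorname{Re}\kappa>0),$$ $$B\{\nu,\kappa\}=\frac{\alpha^{\nu-\kappa}}{\Gamma(\kappa)\,(\nu-\kappa)!}\int_{-\pi/2}^{\pi/2}(\cos x)^{\alpha\kappa}F(x)^{\nu-\kappa}\,dx\qquad(\operatorname{Re}\kappa>-1/\alpha).$$ For every fixed value of $\nu-\kappa\in\{0,1,2,\dots\}$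 these functions of $\kappa$ extend to meromorphic functions on $\mathbb C$, again denoted by $A[\nu,\kappa]$ and $B\{\nu,\kappa\}$. Let $n,d,k\in\mathbb C$ be such that $n-d$ and $d-k$ are fixed, but arbitrary, non-negative integers. Then the following equalities of meromorphic functions of the complex variable $k$ (equivalently, $n$) hold: $$\sum_{\substack{s=0,2,4,\dots\\ s\le d-k,\ m:=d-s}} B\{n,m\}\,\frac{(m+\frac1\alpha)\Gamma(m)}{\Gamma(m+1+\frac2\alpha)}\,A\!\left[m+\tfrac2\alpha,k+\tfrac2\alpha\right]=\sum_{\substack{q=0,2,4,\dots\\ q\le d-k}} B\!\left\{n-\tfrac q\alpha,\,d-q-\tfrac q\alpha\right\}A\!\left[d-q-\tfrac q\alpha,\,k-\tfrac q\alpha\right],$$ $$\sum_{\substack{s=2,4,6,\dots\\ s\le n-d,\ m:=d+s}} B\{n,m\}\,\frac{(m+\frac1\alpha)\Gamma(m)}{\Gamma(m+1+\frac2\alpha)}\,A\!\left[m+\tfrac2\alpha,k+\tfrac2\alpha\right]=\sum_{\substack{q=2,4,6,\dots\\ q\le n-d}} B\!\left\{n+\tfrac q\alpha,\,d+q+\tfrac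 q\alpha\right\}A\!\left[d+q+\tfrac q\alpha,\,k+\tfrac q\alpha\right].$$ -/

import Mathlib

open Filter Set

noncomputable section

namespace BetaPolytope

/-- The branch of `Log (cos x)` on the doubly slit plane
`ℂ \ ((-∞, -π/2) ∪ (π/2, ∞))` that vanishes at `x = 0` (for `x ≠ ±π/2`): the primitive of `-tan`
starting at `0`, computed along the straight segment from `0` to `x`. -/
def logCos (x : ℂ) : ℂ :=
  -∫ t in (0 : ℝ)..1, x * Complex.tan ((t : ℂ) * x)

open Classical in
/-- `(cos x) ^ s = exp (s * Log (cos x))`, with the branch that equals `1` at `x = 0`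
(and the value `0` at the two branch points `±π/2`, where `cos x = 0`). -/
def cosPow (s x : ℂ) : ℂ :=
  if Complex.cos x = 0 then 0 else Complex.exp (s * logCos x)

/-- `F x = ∫_{-π/2}^x (cos y) ^ α dy`, integrated along the contour in the doubly slit plane
that goes straight from `-π/2` to `0` and then straight from `0` to `x`. -/
def F (α : ℝ) (x : ℂ) : ℂ :=
  (∫ y in (-(Real.pi / 2))..(0 : ℝ), cosPow α (y : ℂ)) +
    ∫ t in (0 : ℝ)..1, x * cosPow α ((t : ℂ) * x)

/-- The integral formula for `A[ν, κ]`, where `ν = κ + j`; it is meant for `Re κ > 0`.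
The integral over the imaginary axis is parametrized by `x = i y`, `dx = i dy`. -/
def integralA (α : ℝ) (j : ℕ) (κ : ℂ) : ℂ :=
  (α : ℂ) ^ (j + 1) / (j.factorial : ℂ) *
    (Complex.Gamma (κ + j + 1) / (2 * Real.pi * Complex.I)) *
    ∫ y : ℝ, cosPow (-(α * (κ + j))) (Complex.I * y) * F α (Complex.I * y) ^ j * Complex.I

/-- The integral formula for `B{ν, κ}`, where `ν = κ + j`; it is meant for `Re κ > -1/α`. -/
def integralB (α : ℝ) (j : ℕ) (κ : ℂ) : ℂ :=
  (α : ℂ) ^ j / (Complex.Gamma κ * (j.factorial : ℂ)) *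
    ∫ x in (-(Real.pi / 2))..(Real.pi / 2), cosPow (α * κ) (x : ℂ) * F α (x : ℂ) ^ j

open Classical in
/-- The meromorphic continuation to `ℂ` of the restriction of `f` to `U`, if there is one,
with removable singularities removed (and the value `0` at the poles). By the identity theorem
it is unique when `U` is open and non-empty. -/
def meromorphicContinuation (f : ℂ → ℂ) (U : Set ℂ) : ℂ → ℂ :=
  if h : ∃ g : ℂ → ℂ, MeromorphicNFOn g univ ∧ EqOn g f U then h.choose else 0

open Classical in
/-- The quantity `A[ν, κ]` for `ν - κ ∈ ℤ`: zero if `ν - κ` is negative, and for fixed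
`ν - κ = j ∈ ℕ` the meromorphic continuation in `κ` of its integral formula. -/
def A (α : ℝ) (ν κ : ℂ) : ℂ :=
  if h : ∃ j : ℕ, ν - κ = j then
    meromorphicContinuation (integralA α h.choose) {z | 0 < z.re} κ
  else 0

open Classical in
/-- The quantity `B{ν, κ}` for `ν - κ ∈ ℤ`: zero if `ν - κ` is negative, and for fixed
`ν - κ = j ∈ ℕ` the meromorphic continuation in `κ` of its integral formula. -/
def B (α : ℝ) (ν κ : ℂ) : ℂ :=
  if h : ∃ j : ℕ, ν - κ = j then
    meromorphicContinuation (integralB α h.choose) {z | -(1 / α) < z.re} κ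
  else 0

end BetaPolytope

end

noncomputable section

namespace BetaPolytope

open Topology MeasureTheory

/-! Write C(w, j) and H(w, j) for `cosIntegral` and `coshIntegral`, the integrals of cos^w F^j / j!
over the real interval and over the imaginary axis, read as zero for j < 0. Both satisfy (1 + w)
I(w+1, j) - w I(w-1, j) + I(w+2α+1, j-2) / (w+α+1) = 0, because the left side is the integral of the
exact derivative in `hasDerivAt_primitive`, whose primitive tends to zero at both ends of the
contour.

In the rescaled variable (α times the second index of B) the Gamma factors cancel. Up to one common
constant, the summands on the left become E(m, s) = (m+1) C(m, N-s) H(-m-2, K+s), and those on the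
right become D(m, s) = m C(m, N-s) H(-m, K+s). The recurrence for H gives E(m, s) = D(m, s) + G(m-α,
s-1); the recurrence for C gives E(m, s) = D(m+2, s) + G(m+2+α, s+1), with the same G
(`ladderE_eq_left`, `ladderE_eq_right`). Alternating the two relations moves m in steps of 2 and
turns each E into the D required, at the price of G terms on the neighbouring odd levels. Summed
over even s these cancel between consecutive levels, and the outermost ones vanish because a divided
power in them has negative index (`sum_ladder_down`, `sum_ladder_up`).

This works where all integrals converge, on a half-plane in k. The same recurrence, solved for the
term of smaller |w|-decay, supplies the meromorphic continuations (`exists_meromorphic_extension`),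
and the identity theorem carries the equalities to all k outside a closed discrete set. -/

/-! ### Continuation of meromorphic functions and holomorphy of parameter integrals. -/

/-- A meromorphic function on `ℂ` which vanishes on a non-empty open set vanishes off a closed
discrete set. -/
theorem eventually_codiscrete_eq_zero {f : ℂ → ℂ} (hf : Meromorphic f) {U : Set ℂ}
    (hU : IsOpen U) (hne : U.Nonempty) (h : ∀ z ∈ U, f z = 0) :
    ∀ᶠ z in codiscrete ℂ, f z = 0 := by
  obtain ⟨u, hu⟩ := hne
  have hu_top : meromorphicOrderAt f u = ⊤ := by
    rw [meromorphicOrderAt_eq_top_iff]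
    exact (eventually_of_mem (hU.mem_nhds hu) h).filter_mono nhdsWithin_le_nhds
  have hall : ∀ z, meromorphicOrderAt f z = ⊤ := by
    intro z
    by_contra hz
    exact hf.meromorphicOn.meromorphicOrderAt_ne_top_of_isPreconnected isPreconnected_univ
      (mem_univ z) (mem_univ u) hz hu_top
  rw [eventually_iff, mem_codiscrete]
  intro z
  rw [disjoint_principal_right]
  have := meromorphicOrderAt_eq_top_iff.1 (hall z)
  filter_upwards [this] with w hw
  simpa using hw

/-- If `f` is holomorphic on `U` and agrees there with a meromorphic function on `ℂ`, its
meromorphic continuation exists. -/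
theorem meromorphicContinuation_spec {f g : ℂ → ℂ} {U : Set ℂ} (hU : IsOpen U)
    (hf : DifferentiableOn ℂ f U) (hg : Meromorphic g) (hfg : EqOn g f U) :
    Meromorphic (meromorphicContinuation f U) ∧ EqOn (meromorphicContinuation f U) f U := by
  have h : ∃ g : ℂ → ℂ, MeromorphicNFOn g univ ∧ EqOn g f U := by
    -- Passing to normal form does not disturb the values on `U`: there `g` agrees with the
    -- holomorphic `f`, so it is analytic and already in normal form.
    refine ⟨toMeromorphicNFOn g univ, meromorphicNFOn_toMeromorphicNFOn g univ, fun z hz => ?_⟩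
    rw [toMeromorphicNFOn_eq_toMeromorphicNFAt hg.meromorphicOn (mem_univ z)]
    have han : AnalyticAt ℂ g z :=
      ((hf.congr hfg).analyticOnNhd hU) z hz
    rw [toMeromorphicNFAt_eq_self.2 han.meromorphicNFAt, hfg hz]
  rw [meromorphicContinuation, dif_pos h]
  exact ⟨meromorphicOn_univ.1 h.choose_spec.1.meromorphicOn, h.choose_spec.2⟩

/-- A holomorphic function on a right half-plane satisfying a first order inhomogeneous difference
equation with meromorphic coefficients extends meromorphically to `ℂ`. -/
theorem exists_meromorphic_extension {f R S : ℂ → ℂ} {c δ : ℝ} (hδ : 0 < δ)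
    (hf : DifferentiableOn ℂ f {z | c < z.re}) (hR : Meromorphic R) (hS : Meromorphic S)
    (h : ∀ z : ℂ, c < z.re → f z = R z * f (z + δ) + S z) :
    ∃ g : ℂ → ℂ, Meromorphic g ∧ ∀ z : ℂ, c < z.re → g z = f z := by
  -- `Φ n` applies the difference equation n times, so it only needs `f` at z + nδ and is
  -- meromorphic on Re z > c - nδ.
  let Φ : ℕ → ℂ → ℂ := fun n => Nat.rec f (fun _ G z => R z * G (z + δ) + S z) n
  have hΦ : ∀ n z, Φ (n + 1) z = R z * Φ n (z + δ) + S z := fun _ _ => rfl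
  have hmer : ∀ n : ℕ, ∀ z : ℂ, c < z.re + n * δ → MeromorphicAt (Φ n) z := by
    intro n
    induction n with
    | zero =>
      intro z hz
      have hz' : c < z.re := by simpa using hz
      exact ((hf.analyticOnNhd (isOpen_lt continuous_const Complex.continuous_re)) z
        hz').meromorphicAt
    | succ n ih =>
      intro z hz
      have h1 : MeromorphicAt (Φ n) (z + δ) := ih _ (by
        push_cast at hz; simp only [Complex.add_re, Complex.ofReal_re]; linarith)
      have h2 : MeromorphicAt (fun z => Φ n (z + δ)) z :=
        h1.comp_analyticAt (g := fun z : ℂ => z + δ) (by fun_prop)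
      exact ((hR z).mul h2).add (hS z)
  have hstep : ∀ n : ℕ, ∀ z : ℂ, c < z.re + n * δ → Φ (n + 1) z = Φ n z := by
    intro n
    induction n with
    | zero =>
      intro z hz
      exact (h z (by simpa using hz)).symm
    | succ n ih =>
      intro z hz
      rw [hΦ (n + 1) z, hΦ n z, ih]
      push_cast at hz
      simp only [Complex.add_re, Complex.ofReal_re]
      linarith
  have hle : ∀ n m : ℕ, n ≤ m → ∀ z : ℂ, c < z.re + n * δ → Φ m z = Φ n z := by
    intro n m hnm z hz
    induction m, hnm using Nat.le_induction with
    | base => rfl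
    | succ m hm ih =>
      rw [hstep m z _, ih]
      have : (n : ℝ) * δ ≤ m * δ := by gcongr
      linarith
  have hex : ∀ z : ℂ, ∃ n : ℕ, c < z.re + n * δ := by
    intro z
    obtain ⟨n, hn⟩ := exists_nat_gt ((c - z.re) / δ)
    exact ⟨n, by rw [div_lt_iff₀ hδ] at hn; linarith⟩
  choose ν hν using hex
  -- The iterates agree on overlaps, so the arbitrary choice of `ν z` is immaterial and a single
  -- iterate represents the glued function near each point.
  have hind : ∀ n : ℕ, ∀ z : ℂ, c < z.re + n * δ → Φ (ν z) z = Φ n z := by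
    intro n z hz
    rcases le_total n (ν z) with h1 | h1
    · exact hle _ _ h1 z hz
    · exact (hle _ _ h1 z (hν z)).symm
  refine ⟨fun z => Φ (ν z) z, fun z => ?_, fun z hz => hind 0 z (by simpa using hz)⟩
  refine (hmer _ z (hν z)).congr ?_
  have : ∀ᶠ w : ℂ in 𝓝 z, c < w.re + ν z * δ :=
    (isOpen_lt continuous_const (by fun_prop : Continuous fun w : ℂ => w.re + ν z * δ)).mem_nhds
      (hν z)
  exact (this.mono fun w hw => (hind _ w hw).symm).filter_mono nhdsWithin_le_nhds

/-- `w ↦ ∫ exp (w ℓ) φ` is holomorphic on every half-plane on which it converges absolutely. -/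
theorem differentiableOn_integral_exp {μ : Measure ℝ} {ℓ : ℝ → ℝ} {φ : ℝ → ℂ} {U : Set ℝ}
    (hU : IsOpen U)
    (hℓ : AEStronglyMeasurable ℓ μ)
    (hint : ∀ w : ℂ, w.re ∈ U → Integrable (fun t => Complex.exp (w * ℓ t) * φ t) μ) :
    DifferentiableOn ℂ (fun w : ℂ => ∫ t, Complex.exp (w * ℓ t) * φ t ∂μ) {w | w.re ∈ U} := by
  intro w hw
  apply DifferentiableAt.differentiableWithinAt
  obtain ⟨ε, hε, hball⟩ := Metric.isOpen_iff.1 hU w.re hw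
  set η := ε / 4 with hη
  have hη0 : 0 < η := by positivity
  have hmem : ∀ x : ℝ, |x| < ε → ((w + x : ℂ)).re ∈ U := by
    intro x hx
    apply hball
    simpa [Real.dist_eq] using hx
  have hp := (hint (w + ((2 * η : ℝ) : ℂ)) (hmem _ (by rw [abs_of_pos (by positivity)]; linarith))).norm
  have hm := (hint (w + ((-(2 * η) : ℝ) : ℂ))
    (hmem _ (by rw [abs_neg, abs_of_pos (by positivity)]; linarith))).norm
  have hl : AEStronglyMeasurable (fun t => ((ℓ t : ℝ) : ℂ)) μ :=
    Complex.continuous_ofReal.comp_aestronglyMeasurable hℓ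
  refine (hasDerivAt_integral_of_dominated_loc_of_deriv_le (𝕜 := ℂ) (μ := μ)
    (F := fun w t => Complex.exp (w * ℓ t) * φ t)
    (F' := fun w t => ℓ t * (Complex.exp (w * ℓ t) * φ t))
    (bound := fun t => (1 / η) * (‖Complex.exp ((w + ((2 * η : ℝ) : ℂ)) * ℓ t) * φ t‖ +
      ‖Complex.exp ((w + ((-(2 * η) : ℝ) : ℂ)) * ℓ t) * φ t‖))
    (Metric.ball_mem_nhds w hη0) ?_ (hint w hw) ?_ ?_ ((hp.add hm).const_mul _) ?_).2.differentiableAt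
  · filter_upwards [Metric.ball_mem_nhds w hε] with v hv
    refine (hint v (hball ?_)).aestronglyMeasurable
    rw [Metric.mem_ball, Real.dist_eq]
    rw [Metric.mem_ball, dist_eq_norm] at hv
    exact lt_of_le_of_lt (by simpa using Complex.abs_re_le_norm (v - w)) hv
  · exact hl.mul (hint w hw).aestronglyMeasurable
  · refine Eventually.of_forall fun t v hv => ?_
    have hre : |v.re - w.re| < η := by
      rw [Metric.mem_ball, dist_eq_norm] at hv
      exact lt_of_le_of_lt (by simpa using Complex.abs_re_le_norm (v - w)) hv
    simp only [norm_mul, Complex.norm_exp]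
    rw [← mul_assoc, ← add_mul, ← mul_assoc]
    refine mul_le_mul_of_nonneg_right ?_ (norm_nonneg _)
    have e1 : ∀ z : ℂ, (z * (ℓ t : ℂ)).re = z.re * ℓ t := by intro z; simp
    simp only [e1, Complex.norm_real, Complex.add_re, Complex.ofReal_re, Real.norm_eq_abs]
    have hlin : η * |ℓ t| ≤ Real.exp (η * |ℓ t|) := by
      linarith [Real.add_one_le_exp (η * |ℓ t|)]
    have key : η * |ℓ t| * Real.exp (v.re * ℓ t) ≤
        Real.exp ((w.re + 2 * η) * ℓ t) + Real.exp ((w.re + -(2 * η)) * ℓ t) := by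
      calc η * |ℓ t| * Real.exp (v.re * ℓ t)
          ≤ Real.exp (η * |ℓ t|) * Real.exp (v.re * ℓ t) := by gcongr
        _ = Real.exp (η * |ℓ t| + v.re * ℓ t) := by rw [Real.exp_add]
        _ ≤ Real.exp (w.re * ℓ t + 2 * η * |ℓ t|) := by
            apply Real.exp_le_exp.2
            have : (v.re - w.re) * ℓ t ≤ η * |ℓ t| := by
              calc (v.re - w.re) * ℓ t ≤ |(v.re - w.re) * ℓ t| := le_abs_self _
                _ = |v.re - w.re| * |ℓ t| := abs_mul _ _
                _ ≤ η * |ℓ t| := by gcongr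
            linarith
        _ ≤ _ := by
            rcases abs_cases (ℓ t) with ⟨h1, _⟩ | ⟨h1, _⟩
            · rw [h1, ← add_mul]
              linarith [Real.exp_pos ((w.re + -(2 * η)) * ℓ t)]
            · rw [h1, show w.re * ℓ t + 2 * η * -ℓ t = (w.re + -(2 * η)) * ℓ t by ring]
              linarith [Real.exp_pos ((w.re + 2 * η) * ℓ t)]
    rw [one_div, inv_mul_eq_div, le_div_iff₀ hη0]
    linarith
  · refine Eventually.of_forall fun t v _ => ?_
    have := (((hasDerivAt_id v).mul_const (ℓ t : ℂ)).cexp).mul_const (φ t)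
    exact this.congr_deriv (by simp only [id]; ring)

/-! ### Telescoping of abstract ladder relations. -/

/-- Downward telescoping of the two ladder relations. -/
theorem ladder_down {D E G : ℂ → ℤ → ℂ} {α : ℂ} (m : ℂ) (s : ℤ) (n : ℕ)
    (h₁ : ∀ p : ℕ, p ≤ n → E (m - 2 * p) s = D (m - 2 * p) s + G (m - 2 * p - α) (s - 1))
    (h₂ : ∀ p : ℕ, p < n → E (m - 2 * (p + 1)) s =
      D (m - 2 * p) s + G (m - 2 * p + α) (s + 1)) :
    E m s = D (m - 2 * n) s + ∑ p ∈ Finset.range (n + 1), G (m - 2 * p - α) (s - 1)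
      - ∑ p ∈ Finset.range n, G (m - 2 * p + α) (s + 1) := by
  induction n with
  | zero => simpa using h₁ 0 le_rfl
  | succ n ih =>
    rw [ih (fun p hp => h₁ p (by omega)) (fun p hp => h₂ p (by omega)),
      Finset.sum_range_succ _ (n + 1),
      Finset.sum_range_succ (fun p : ℕ => G (m - 2 * p + α) (s + 1)) n]
    have e1 := h₁ (n + 1) le_rfl
    have e2 := h₂ n (by omega)
    push_cast at e1 e2 ⊢
    linear_combination e1 - e2

/-- Upward telescoping of the two ladder relations. -/
theorem ladder_up {D E G : ℂ → ℤ → ℂ} {α : ℂ} (m : ℂ) (s : ℤ) (n : ℕ)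
    (h₁ : ∀ p : ℕ, p < n → E (m + 2 * (p + 1)) s =
      D (m + 2 * (p + 1)) s + G (m + 2 * (p + 1) - α) (s - 1))
    (h₂ : ∀ p : ℕ, p ≤ n → E (m + 2 * p) s =
      D (m + 2 * (p + 1)) s + G (m + 2 * (p + 1) + α) (s + 1)) :
    E m s = D (m + 2 * (n + 1)) s + ∑ p ∈ Finset.range (n + 1), G (m + 2 * (p + 1) + α) (s + 1)
      - ∑ p ∈ Finset.range n, G (m + 2 * (p + 1) - α) (s - 1) := by
  induction n with
  | zero => simpa using h₂ 0 le_rfl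
  | succ n ih =>
    rw [ih (fun p hp => h₁ p (by omega)) (fun p hp => h₂ p (by omega)),
      Finset.sum_range_succ _ (n + 1),
      Finset.sum_range_succ (fun p : ℕ => G (m + 2 * (p + 1) - α) (s - 1)) n]
    have e1 := h₁ n (by omega)
    have e2 := h₂ (n + 1) le_rfl
    push_cast at e1 e2 ⊢
    linear_combination e2 - e1

theorem sum_even_range (f : ℕ → ℂ) (K : ℕ) :
    ∑ s ∈ (Finset.range (K + 1)).filter Even, f s =
      ∑ σ ∈ Finset.range (K / 2 + 1), f (2 * σ) := by
  symm
  refine Finset.sum_bij (fun σ _ => 2 * σ) ?_ ?_ ?_ ?_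
  · intro σ hσ
    simp only [Finset.mem_filter, Finset.mem_range, even_two, Even.mul_right, and_true] at hσ ⊢
    omega
  · intro a _ b _ h; omega
  · intro b hb
    simp only [Finset.mem_filter, Finset.mem_range] at hb
    obtain ⟨r, hr⟩ := hb.2
    exact ⟨r, by simp only [Finset.mem_range]; omega, by omega⟩
  · intros; rfl

theorem sum_even_Icc (f : ℕ → ℂ) (N : ℕ) :
    ∑ s ∈ (Finset.Icc 1 N).filter Even, f s =
      ∑ σ ∈ Finset.range (N / 2), f (2 * (σ + 1)) := by
  symm
  refine Finset.sum_bij (fun σ _ => 2 * (σ + 1)) ?_ ?_ ?_ ?_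
  · intro σ hσ
    simp only [Finset.mem_filter, Finset.mem_range, Finset.mem_Icc, even_two, Even.mul_right,
      and_true] at hσ ⊢
    omega
  · intro a _ b _ h; omega
  · intro b hb
    simp only [Finset.mem_filter, Finset.mem_Icc] at hb
    obtain ⟨r, hr⟩ := hb.2
    exact ⟨r - 1, by simp only [Finset.mem_range]; omega, by omega⟩
  · intros; rfl

/-- On level s = -2σ, σ double steps turn E into D shifted down by 2σ, leaving σ + 1 terms G on
level s - 1 and σ terms with opposite sign on level s + 1. The former are exactly the ones cancelled
by the next even level. -/
theorem sum_ladder_down {D E G : ℂ → ℤ → ℂ} {α : ℂ} (e : ℂ) (K : ℕ)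
    (h₁ : ∀ s : ℤ, -K ≤ s → s ≤ 0 → ∀ p : ℕ, p ≤ K → E (e + α * s - 2 * p) s =
      D (e + α * s - 2 * p) s + G (e + α * s - 2 * p - α) (s - 1))
    (h₂ : ∀ s : ℤ, -K ≤ s → s ≤ 0 → ∀ p : ℕ, p < K → E (e + α * s - 2 * (p + 1)) s =
      D (e + α * s - 2 * p) s + G (e + α * s - 2 * p + α) (s + 1))
    (hG : ∀ m s, s ≤ -(K : ℤ) → G m s = 0) :
    ∑ s ∈ (Finset.range (K + 1)).filter Even, E (e - α * s) (-s) =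
      ∑ s ∈ (Finset.range (K + 1)).filter Even, D (e - (α + 1) * s) (-s) := by
  rw [sum_even_range (fun s => E (e - α * s) (-s)),
    sum_even_range (fun s => D (e - (α + 1) * s) (-s)), ← sub_eq_zero, ← Finset.sum_sub_distrib]
  -- `Δ n` collects the G terms on the odd level 1 - 2n; `Δ 0` is empty.
  let Δ : ℕ → ℂ := fun n => ∑ p ∈ Finset.range n, G (e - 2 * p + α * (1 - 2 * n)) (1 - 2 * n)
  have key : ∀ σ ∈ Finset.range (K / 2 + 1),
      E (e - α * (2 * σ : ℕ)) (-(2 * σ : ℕ)) - D (e - (α + 1) * (2 * σ : ℕ)) (-(2 * σ : ℕ)) =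
        Δ (σ + 1) - Δ σ := by
    intro σ hσ
    rw [Finset.mem_range] at hσ
    have h := ladder_down (D := D) (E := E) (G := G) (α := α)
      (e + α * ((-(2 * σ : ℕ) : ℤ) : ℂ)) (-(2 * σ : ℕ)) σ
      (fun p hp => h₁ _ (by omega) (by omega) p (by omega))
      (fun p hp => h₂ _ (by omega) (by omega) p (by omega))
    simp only [Δ]
    rw [show e - α * ((2 * σ : ℕ) : ℂ) = e + α * ((-(2 * σ : ℕ) : ℤ) : ℂ) by push_cast; ring, h,
      show e - (α + 1) * ((2 * σ : ℕ) : ℂ) = e + α * ((-(2 * σ : ℕ) : ℤ) : ℂ) - 2 * σ by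
        push_cast; ring]
    have a1 : ∀ p : ℕ, G (e + α * ((-(2 * σ : ℕ) : ℤ) : ℂ) - 2 * p - α) (-(2 * σ : ℕ) - 1) =
        G (e - 2 * p + α * (1 - 2 * (σ + 1 : ℕ))) (1 - 2 * (σ + 1 : ℕ)) := by
      intro p; congr 1 <;> push_cast <;> ring
    have a2 : ∀ p : ℕ, G (e + α * ((-(2 * σ : ℕ) : ℤ) : ℂ) - 2 * p + α) (-(2 * σ : ℕ) + 1) =
        G (e - 2 * p + α * (1 - 2 * σ)) (1 - 2 * σ) := by
      intro p; congr 1 <;> push_cast <;> ring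
    simp only [a1, a2]
    ring
  rw [Finset.sum_congr rfl key, Finset.sum_range_sub]
  simp only [Δ, Finset.range_zero, Finset.sum_empty, sub_zero]
  -- The surviving level is -1 - 2⌊K/2⌋, which is at most -K for either parity of K.
  refine Finset.sum_eq_zero fun p _ => hG _ _ ?_
  omega

/-- Mirror image of `sum_ladder_down`: the shifts go upwards, and the surviving level 2⌊N/2⌋ + 1 is
at least N. -/
theorem sum_ladder_up {D E G : ℂ → ℤ → ℂ} {α : ℂ} (e : ℂ) (N : ℕ)
    (h₁ : ∀ s : ℤ, 0 ≤ s → s ≤ N → ∀ p : ℕ, p < N → E (e + α * s + 2 * (p + 1)) s =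
      D (e + α * s + 2 * (p + 1)) s + G (e + α * s + 2 * (p + 1) - α) (s - 1))
    (h₂ : ∀ s : ℤ, 0 ≤ s → s ≤ N → ∀ p : ℕ, p ≤ N → E (e + α * s + 2 * p) s =
      D (e + α * s + 2 * (p + 1)) s + G (e + α * s + 2 * (p + 1) + α) (s + 1))
    (hG : ∀ m s, (N : ℤ) ≤ s → G m s = 0) :
    ∑ s ∈ (Finset.Icc 1 N).filter Even, E (e + α * s) s =
      ∑ s ∈ (Finset.Icc 1 N).filter Even, D (e + (α + 1) * s) s := by
  rw [sum_even_Icc (fun s => E (e + α * s) s),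
    sum_even_Icc (fun s => D (e + (α + 1) * s) s), ← sub_eq_zero, ← Finset.sum_sub_distrib]
  let Δ : ℕ → ℂ := fun n =>
    ∑ p ∈ Finset.range n, G (e + 2 * (p + 1) + α * (2 * n + 1)) (2 * n + 1)
  have key : ∀ σ ∈ Finset.range (N / 2),
      E (e + α * (2 * (σ + 1) : ℕ)) (2 * (σ + 1) : ℕ) -
        D (e + (α + 1) * (2 * (σ + 1) : ℕ)) (2 * (σ + 1) : ℕ) = Δ (σ + 1) - Δ σ := by
    intro σ hσ
    rw [Finset.mem_range] at hσ
    have h := ladder_up (D := D) (E := E) (G := G) (α := α)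
      (e + α * (((2 * (σ + 1) : ℕ) : ℤ) : ℂ)) (2 * (σ + 1) : ℕ) σ
      (fun p hp => h₁ _ (by omega) (by omega) p (by omega))
      (fun p hp => h₂ _ (by omega) (by omega) p (by omega))
    simp only [Δ]
    rw [show e + α * ((2 * (σ + 1) : ℕ) : ℂ) = e + α * (((2 * (σ + 1) : ℕ) : ℤ) : ℂ) by
        push_cast; ring, h,
      show e + (α + 1) * ((2 * (σ + 1) : ℕ) : ℂ) =
        e + α * (((2 * (σ + 1) : ℕ) : ℤ) : ℂ) + 2 * (σ + 1) by push_cast; ring]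
    have a1 : ∀ p : ℕ, G (e + α * (((2 * (σ + 1) : ℕ) : ℤ) : ℂ) + 2 * (p + 1) + α)
        ((2 * (σ + 1) : ℕ) + 1) =
        G (e + 2 * (p + 1) + α * (2 * (σ + 1 : ℕ) + 1)) (2 * (σ + 1 : ℕ) + 1) := by
      intro p; congr 1; push_cast; ring
    have a2 : ∀ p : ℕ, G (e + α * (((2 * (σ + 1) : ℕ) : ℤ) : ℂ) + 2 * (p + 1) - α)
        ((2 * (σ + 1) : ℕ) - 1) =
        G (e + 2 * (p + 1) + α * (2 * σ + 1)) (2 * σ + 1) := by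
      intro p; congr 1 <;> push_cast <;> ring
    simp only [a1, a2]
    ring
  rw [Finset.sum_congr rfl key, Finset.sum_range_sub]
  simp only [Δ, Finset.range_zero, Finset.sum_empty, sub_zero]
  refine Finset.sum_eq_zero fun p hp => hG _ _ ?_
  omega

/-! ### Divided powers and the primitive behind the recurrence. -/

/-- The divided power `z ^ j / j!`, extended by zero to negative `j`. -/
def divPow (z : ℂ) (j : ℤ) : ℂ := if j < 0 then 0 else z ^ j.toNat / (j.toNat.factorial : ℂ)

theorem divPow_of_neg (z : ℂ) {j : ℤ} (hj : j < 0) : divPow z j = 0 := if_pos hj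

theorem divPow_natCast (z : ℂ) (j : ℕ) : divPow z j = z ^ j / (j.factorial : ℂ) := by
  simp [divPow]

theorem continuous_divPow (j : ℤ) : Continuous fun z => divPow z j := by
  unfold divPow
  split_ifs <;> fun_prop

theorem HasDerivAt.divPow {f : ℝ → ℂ} {f' : ℂ} {t : ℝ} (hf : HasDerivAt f f' t) (j : ℤ) :
    HasDerivAt (fun t => divPow (f t) j) (divPow (f t) (j - 1) * f') t := by
  rcases lt_trichotomy j 0 with hj | rfl | hj
  · simp only [divPow_of_neg _ hj, divPow_of_neg _ (show j - 1 < 0 by omega), zero_mul]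
    exact hasDerivAt_const _ _
  · simp only [zero_sub, divPow_of_neg _ (show (-1 : ℤ) < 0 by norm_num), zero_mul]
    simpa [BetaPolytope.divPow] using hasDerivAt_const t (1 : ℂ)
  · obtain ⟨n, rfl⟩ : ∃ n : ℕ, j = n + 1 := ⟨(j - 1).toNat, by omega⟩
    have e1 : ∀ z, BetaPolytope.divPow z ((n : ℤ) + 1) = z ^ (n + 1) / ((n + 1).factorial : ℂ) :=
      fun z => by exact_mod_cast divPow_natCast z (n + 1)
    simp only [e1, add_sub_cancel_right, divPow_natCast]
    refine ((hf.pow (n + 1)).div_const _).congr_deriv ?_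
    have h1 : (n.factorial : ℂ) ≠ 0 := by exact_mod_cast n.factorial_ne_zero
    have h2 : (n : ℂ) + 1 ≠ 0 := by exact_mod_cast n.succ_ne_zero
    rw [Nat.factorial_succ]
    push_cast
    field_simp

theorem norm_divPow_le (z : ℂ) (j : ℤ) : ‖divPow z j‖ ≤ ‖z‖ ^ j.toNat := by
  unfold divPow
  split_ifs with h
  · simp
  · rw [norm_div, norm_pow]
    refine div_le_self (by positivity) ?_
    simp only [Complex.norm_natCast]
    exact_mod_cast Nat.one_le_iff_ne_zero.2 (Nat.factorial_ne_zero _)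

/-- The second summand is chosen so that its derivative cancels the cross term cos^(w+α) sin ·
F^(j-1)/(j-1)! coming from the first; sin² = 1 - cos² does the rest. The parameter ω is the speed of
the contour, so that ω = 1 and ω = i treat the real and the imaginary axis at once. -/
theorem hasDerivAt_primitive {c : ℝ → ℝ} {s f : ℝ → ℂ} {ω w α : ℂ} {c' t : ℝ} {j : ℤ}
    (hc : 0 < c t) (hcd : HasDerivAt c c' t) (hc' : (c' : ℂ) = -ω * s t)
    (hs : HasDerivAt s (ω * c t) t) (hf : HasDerivAt f (ω * Complex.exp (α * Real.log (c t))) t)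
    (hsq : (c t : ℂ) ^ 2 + s t ^ 2 = 1) (hw : w + α + 1 ≠ 0 ∨ j ≤ 0) :
    HasDerivAt (fun t => Complex.exp (w * Real.log (c t)) * s t * divPow (f t) j +
        Complex.exp ((w + α + 1) * Real.log (c t)) * divPow (f t) (j - 1) / (w + α + 1))
      ((1 + w) * (Complex.exp ((w + 1) * Real.log (c t)) * (divPow (f t) j * ω)) -
        w * (Complex.exp ((w - 1) * Real.log (c t)) * (divPow (f t) j * ω)) +
        Complex.exp ((w + 2 * α + 1) * Real.log (c t)) * (divPow (f t) (j - 2) * ω) /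
          (w + α + 1)) t := by
  have hc0 : (c t : ℂ) ≠ 0 := by exact_mod_cast hc.ne'
  have hℓ : HasDerivAt (fun t => ((Real.log (c t) : ℝ) : ℂ)) (-ω * s t / c t) t := by
    refine ((hcd.log hc.ne').ofReal_comp).congr_deriv ?_
    push_cast
    rw [hc']
  have hexp : ∀ v : ℂ, HasDerivAt (fun t => Complex.exp (v * Real.log (c t)))
      (Complex.exp (v * Real.log (c t)) * (v * (-ω * s t / c t))) t := fun v =>
    (hℓ.const_mul v).cexp
  have hcexp : Complex.exp (Real.log (c t) : ℂ) = c t := by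
    rw [← Complex.ofReal_exp, Real.exp_log hc]
  have h := (((hexp w).mul hs).mul (HasDerivAt.divPow hf j)).add
    (((hexp (w + α + 1)).mul (HasDerivAt.divPow hf (j - 1))).div_const (w + α + 1))
  refine h.congr_deriv ?_
  have e1 : Complex.exp ((w + 1) * Real.log (c t)) = Complex.exp (w * Real.log (c t)) * c t := by
    rw [add_mul, one_mul, Complex.exp_add, hcexp]
  have e2 : Complex.exp ((w - 1) * Real.log (c t)) = Complex.exp (w * Real.log (c t)) / c t := by
    rw [sub_mul, one_mul, Complex.exp_sub, hcexp]
  have e3 : Complex.exp ((w + α + 1) * Real.log (c t)) =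
      Complex.exp (w * Real.log (c t)) * Complex.exp (α * Real.log (c t)) * c t := by
    rw [add_mul, add_mul, one_mul, Complex.exp_add, Complex.exp_add, hcexp]
  have e4 : Complex.exp ((w + 2 * α + 1) * Real.log (c t)) =
      Complex.exp (w * Real.log (c t)) * Complex.exp (α * Real.log (c t)) ^ 2 * c t := by
    rw [← Complex.exp_nat_mul, ← hcexp, ← Complex.exp_add, ← Complex.exp_add]
    push_cast
    ring_nf
  rw [e1, e2, e3, e4, show j - 1 - 1 = j - 2 by ring]
  have hs2 : s t ^ 2 = 1 - (c t : ℂ) ^ 2 := by linear_combination hsq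
  -- For j ≤ 0 the terms divided by w + α + 1 carry divided powers of negative index and vanish, so
  -- a zero denominator is harmless.
  rcases hw with hw | hw
  · simp only [Pi.mul_apply]
    field_simp
    linear_combination (-ω * w * divPow (f t) j * (w + α + 1)) * hs2
  · rw [divPow_of_neg _ (show j - 1 < 0 by omega), divPow_of_neg _ (show j - 2 < 0 by omega)]
    simp only [Pi.mul_apply]
    field_simp
    linear_combination (-ω * w * divPow (f t) j) * hs2

/-! ### The branch of the cosine power and its primitive on the two axes. -/

/-- The incomplete integral of `cos ^ α`. -/
def primCos (α x : ℝ) : ℝ := ∫ u in (-(Real.pi / 2))..x, Real.cos u ^ α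

/-- The values of the primitive of `cos ^ α` on the imaginary axis. -/
def primCosh (α y : ℝ) : ℂ :=
  primCos α 0 + Complex.I * ((∫ u in (0 : ℝ)..y, Real.cosh u ^ α : ℝ) : ℂ)

theorem hasDerivAt_primCos {α : ℝ} (hα : 0 < α) (x : ℝ) :
    HasDerivAt (primCos α) (Real.cos x ^ α) x :=
  (Continuous.integral_hasStrictDerivAt
    (Real.continuous_cos.rpow_const fun _ => Or.inr hα.le) _ x).hasDerivAt

theorem continuous_cosh_rpow (α : ℝ) : Continuous fun u => Real.cosh u ^ α :=
  Real.continuous_cosh.rpow_const fun u => Or.inl (Real.cosh_pos u).ne'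

theorem hasDerivAt_primCosh (α y : ℝ) :
    HasDerivAt (primCosh α) (Complex.I * ((Real.cosh y ^ α : ℝ) : ℂ)) y := by
  have h := ((continuous_cosh_rpow α).integral_hasStrictDerivAt 0 y).hasDerivAt.ofReal_comp
  exact (h.const_mul Complex.I).const_add _

theorem logCos_ofReal {x : ℝ} (hx : x ∈ Ioo (-(Real.pi / 2)) (Real.pi / 2)) :
    logCos x = (Real.log (Real.cos x) : ℝ) := by
  have hmem : ∀ t ∈ uIcc (0 : ℝ) 1, t * x ∈ Ioo (-(Real.pi / 2)) (Real.pi / 2) := by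
    intro t ht
    rw [uIcc_of_le zero_le_one] at ht
    have habs : |t * x| < Real.pi / 2 := by
      rw [abs_mul, abs_of_nonneg ht.1]
      calc t * |x| ≤ 1 * |x| := by gcongr; exact ht.2
        _ < Real.pi / 2 := by rw [one_mul]; exact abs_lt.2 hx
    exact abs_lt.1 habs
  have hder : ∀ t ∈ uIcc (0 : ℝ) 1,
      HasDerivAt (fun t : ℝ => -Real.log (Real.cos (t * x))) (x * Real.tan (t * x)) t := by
    intro t ht
    have hpos := Real.cos_pos_of_mem_Ioo (hmem t ht)
    refine ((((hasDerivAt_id t).mul_const x).cos).log hpos.ne').neg.congr_deriv ?_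
    simp only [id, Real.tan_eq_sin_div_cos]
    field_simp
  have hcont : ContinuousOn (fun t : ℝ => x * Real.tan (t * x)) (uIcc (0 : ℝ) 1) := by
    simp only [Real.tan_eq_sin_div_cos]
    refine continuousOn_const.mul (ContinuousOn.div (by fun_prop) (by fun_prop) fun t ht => ?_)
    exact (Real.cos_pos_of_mem_Ioo (hmem t ht)).ne'
  have h := intervalIntegral.integral_eq_sub_of_hasDerivAt hder hcont.intervalIntegrable
  have e : ∀ t : ℝ, (x : ℂ) * Complex.tan ((t : ℂ) * x) = ((x * Real.tan (t * x) : ℝ) : ℂ) := by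
    intro t; push_cast; rfl
  simp only [logCos, e]
  rw [intervalIntegral.integral_ofReal, h]
  simp

theorem logCos_I_mul (y : ℝ) : logCos (Complex.I * y) = (Real.log (Real.cosh y) : ℝ) := by
  have hder : ∀ t ∈ uIcc (0 : ℝ) 1,
      HasDerivAt (fun t : ℝ => -Real.log (Real.cosh (t * y))) (-(y * Real.tanh (t * y))) t := by
    intro t _
    have hpos := Real.cosh_pos (t * y)
    refine ((((hasDerivAt_id t).mul_const y).cosh).log hpos.ne').neg.congr_deriv ?_
    simp only [id, Real.tanh_eq_sinh_div_cosh]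
    field_simp
  have hcont : Continuous (fun t : ℝ => -(y * Real.tanh (t * y))) := by
    simp only [Real.tanh_eq_sinh_div_cosh]
    exact (continuous_const.mul (Continuous.div (by fun_prop) (by fun_prop)
      fun t => (Real.cosh_pos _).ne')).neg
  have h := intervalIntegral.integral_eq_sub_of_hasDerivAt hder (hcont.intervalIntegrable _ _)
  have e : ∀ t : ℝ, Complex.I * y * Complex.tan ((t : ℂ) * (Complex.I * y)) =
      ((-(y * Real.tanh (t * y)) : ℝ) : ℂ) := by
    intro t
    rw [show (t : ℂ) * (Complex.I * y) = ((t * y : ℝ) : ℂ) * Complex.I by push_cast; ring,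
      Complex.tan_mul_I]
    push_cast
    linear_combination (y * Complex.tanh (t * y)) * Complex.I_mul_I
  simp only [logCos, e]
  rw [intervalIntegral.integral_ofReal, h]
  simp

theorem cosPow_ofReal (s : ℂ) {x : ℝ} (hx : x ∈ Ioo (-(Real.pi / 2)) (Real.pi / 2)) :
    cosPow s x = Complex.exp (s * Real.log (Real.cos x)) := by
  have : Complex.cos x ≠ 0 := by
    rw [← Complex.ofReal_cos]
    exact_mod_cast (Real.cos_pos_of_mem_Ioo hx).ne'
  rw [cosPow, if_neg this, logCos_ofReal hx]

theorem cosPow_I_mul (s : ℂ) (y : ℝ) :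
    cosPow s (Complex.I * y) = Complex.exp (s * Real.log (Real.cosh y)) := by
  have : Complex.cos (Complex.I * y) ≠ 0 := by
    rw [mul_comm, Complex.cos_mul_I, ← Complex.ofReal_cosh]
    exact_mod_cast (Real.cosh_pos y).ne'
  rw [cosPow, if_neg this, logCos_I_mul]

theorem exp_ofReal_mul_log {c : ℝ} (hc : 0 < c) (α : ℝ) :
    Complex.exp (α * Real.log c) = ((c ^ α : ℝ) : ℂ) := by
  rw [Real.rpow_def_of_pos hc]
  push_cast
  ring_nf

theorem integral_cosPow_left (α : ℝ) :
    ∫ y in (-(Real.pi / 2))..(0 : ℝ), cosPow α (y : ℂ) = primCos α 0 := by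
  rw [primCos, ← intervalIntegral.integral_ofReal]
  refine intervalIntegral.integral_congr_ae (Eventually.of_forall fun u hu => ?_)
  have hpi := Real.pi_pos
  rw [uIoc_of_le (by linarith)] at hu
  have hu' : u ∈ Ioo (-(Real.pi / 2)) (Real.pi / 2) := ⟨hu.1, by linarith [hu.2]⟩
  rw [cosPow_ofReal _ hu', exp_ofReal_mul_log (Real.cos_pos_of_mem_Ioo hu')]

theorem F_ofReal {α : ℝ} (hα : 0 < α) {x : ℝ}
    (hx : x ∈ Ioo (-(Real.pi / 2)) (Real.pi / 2)) : F α x = primCos α x := by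
  have hcont : Continuous fun u => Real.cos u ^ α :=
    Real.continuous_cos.rpow_const fun _ => Or.inr hα.le
  have h2 : ∫ t in (0 : ℝ)..1, (x : ℂ) * cosPow α ((t : ℂ) * x) =
      ((∫ u in (0 : ℝ)..x, Real.cos u ^ α : ℝ) : ℂ) := by
    have e : ∫ t in (0 : ℝ)..1, (x : ℂ) * cosPow α ((t : ℂ) * x) =
        ∫ t in (0 : ℝ)..1, ((x * Real.cos (t * x) ^ α : ℝ) : ℂ) := by
      refine intervalIntegral.integral_congr fun t ht => ?_
      rw [uIcc_of_le zero_le_one] at ht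
      have habs : |t * x| < Real.pi / 2 := by
        rw [abs_mul, abs_of_nonneg ht.1]
        calc t * |x| ≤ 1 * |x| := by gcongr; exact ht.2
          _ < Real.pi / 2 := by rw [one_mul]; exact abs_lt.2 hx
      have hm : t * x ∈ Ioo (-(Real.pi / 2)) (Real.pi / 2) := abs_lt.1 habs
      rw [← Complex.ofReal_mul, cosPow_ofReal _ hm, exp_ofReal_mul_log (Real.cos_pos_of_mem_Ioo hm)]
      push_cast
      rfl
    rw [e, intervalIntegral.integral_ofReal, intervalIntegral.integral_const_mul,
      intervalIntegral.mul_integral_comp_mul_right (f := fun u => Real.cos u ^ α)]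
    simp
  rw [F, integral_cosPow_left, h2, ← Complex.ofReal_add, primCos, primCos,
    intervalIntegral.integral_add_adjacent_intervals (hcont.intervalIntegrable _ _)
      (hcont.intervalIntegrable _ _)]

theorem F_I_mul (α y : ℝ) : F α (Complex.I * y) = primCosh α y := by
  have e : ∀ t : ℝ, Complex.I * y * cosPow α ((t : ℂ) * (Complex.I * y)) =
      Complex.I * ((y * Real.cosh (t * y) ^ α : ℝ) : ℂ) := by
    intro t
    rw [show (t : ℂ) * (Complex.I * y) = Complex.I * ((t * y : ℝ) : ℂ) by push_cast; ring,
      cosPow_I_mul, exp_ofReal_mul_log (Real.cosh_pos _)]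
    push_cast
    ring
  rw [F, integral_cosPow_left, primCosh]
  simp only [e]
  rw [intervalIntegral.integral_const_mul, intervalIntegral.integral_ofReal,
    intervalIntegral.integral_const_mul,
    intervalIntegral.mul_integral_comp_mul_right (f := fun u => Real.cosh u ^ α)]
  simp

/-! ### The two integrals stripped of their Gamma factors. -/

/-- The integral of `cos ^ w` against a divided power of its primitive. -/
def cosIntegral (α : ℝ) (w : ℂ) (j : ℤ) : ℂ :=
  ∫ x in Ioo (-(Real.pi / 2)) (Real.pi / 2),
    Complex.exp (w * Real.log (Real.cos x)) * divPow (primCos α x) j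

/-- The integral of `cos ^ w` against a divided power of the primitive of `cos ^ α` along the
imaginary axis. -/
def coshIntegral (α : ℝ) (w : ℂ) (j : ℤ) : ℂ :=
  ∫ y : ℝ, Complex.exp (w * Real.log (Real.cosh y)) * (divPow (primCosh α y) j * Complex.I)

theorem integralB_eq {α : ℝ} (hα : 0 < α) (j : ℕ) (κ : ℂ) :
    integralB α j κ = (α : ℂ) ^ j * (Complex.Gamma κ)⁻¹ * cosIntegral α (α * κ) j := by
  have hpi := Real.pi_pos
  rw [integralB, cosIntegral, intervalIntegral.integral_of_le (by linarith),
    integral_Ioc_eq_integral_Ioo]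
  have : ∫ x in Ioo (-(Real.pi / 2)) (Real.pi / 2), cosPow (α * κ) (x : ℂ) * F α (x : ℂ) ^ j =
      ∫ x in Ioo (-(Real.pi / 2)) (Real.pi / 2), (j.factorial : ℂ) *
        (Complex.exp (α * κ * Real.log (Real.cos x)) * divPow (primCos α x) j) := by
    refine setIntegral_congr_fun measurableSet_Ioo fun x hx => ?_
    have h1 : (j.factorial : ℂ) ≠ 0 := by exact_mod_cast j.factorial_ne_zero
    rw [cosPow_ofReal _ hx, F_ofReal hα hx, divPow_natCast]
    field_simp
  have h1 : (j.factorial : ℂ) ≠ 0 := by exact_mod_cast j.factorial_ne_zero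
  rw [this, integral_const_mul, div_eq_mul_inv, mul_inv]
  field_simp

theorem integralA_eq (α : ℝ) (j : ℕ) (κ : ℂ) :
    integralA α j κ = (α : ℂ) ^ (j + 1) * (Complex.Gamma (κ + j + 1) / (2 * Real.pi * Complex.I)) *
      coshIntegral α (-(α * (κ + j))) j := by
  have h1 : (j.factorial : ℂ) ≠ 0 := by exact_mod_cast j.factorial_ne_zero
  rw [integralA, coshIntegral]
  have : ∀ y : ℝ, cosPow (-(α * (κ + j))) (Complex.I * y) * F α (Complex.I * y) ^ j * Complex.I =
      (j.factorial : ℂ) * (Complex.exp (-(α * (κ + j)) * Real.log (Real.cosh y)) *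
        (divPow (primCosh α y) j * Complex.I)) := by
    intro y
    rw [cosPow_I_mul, F_I_mul, divPow_natCast]
    field_simp
  simp only [this]
  rw [integral_const_mul]
  field_simp

/-! ### Absolute convergence and holomorphy of the two integrals. -/

theorem norm_exp_mul_log (w : ℂ) (c : ℝ) :
    ‖Complex.exp (w * Real.log c)‖ = Real.exp (w.re * Real.log c) := by
  rw [Complex.norm_exp]
  simp

theorem integrableOn_exp_mul_log_cos {σ : ℝ} (hσ : -1 < σ) :
    IntegrableOn (fun x => Real.exp (σ * Real.log (Real.cos x)))
      (Ioo (-(Real.pi / 2)) (Real.pi / 2)) := by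
  have hpi := Real.pi_pos
  have hmeas : AEStronglyMeasurable (fun x => Real.exp (σ * Real.log (Real.cos x)))
      (volume.restrict (Ioo (-(Real.pi / 2)) (Real.pi / 2))) :=
    (Real.measurable_exp.comp
      ((Real.measurable_log.comp Real.measurable_cos).const_mul σ)).aestronglyMeasurable
  rcases le_or_gt 0 σ with h0 | h0
  · refine Integrable.mono' (g := fun _ => (1 : ℝ)) (integrable_const _) hmeas ?_
    filter_upwards [self_mem_ae_restrict measurableSet_Ioo] with x hx
    rw [Real.norm_eq_abs, abs_of_pos (Real.exp_pos _)]
    exact Real.exp_le_one_iff.2 (mul_nonpos_of_nonneg_of_nonpos h0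
      (Real.log_nonpos (Real.cos_pos_of_mem_Ioo hx).le (Real.cos_le_one x)))
  · have hI : IntervalIntegrable (fun x : ℝ => x ^ σ) volume 0 Real.pi :=
      intervalIntegral.intervalIntegrable_rpow' hσ
    have h1 : IntegrableOn (fun x : ℝ => (Real.pi / 2 - x) ^ σ)
        (Ioo (-(Real.pi / 2)) (Real.pi / 2)) := by
      have := hI.symm.comp_sub_left (Real.pi / 2)
      rw [show Real.pi / 2 - Real.pi = -(Real.pi / 2) by ring, sub_zero] at this
      exact ((intervalIntegrable_iff_integrableOn_Ioc_of_le (by linarith)).1 this).mono_set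
        Ioo_subset_Ioc_self
    have h2 : IntegrableOn (fun x : ℝ => (x + Real.pi / 2) ^ σ)
        (Ioo (-(Real.pi / 2)) (Real.pi / 2)) := by
      have := hI.comp_add_right (Real.pi / 2)
      rw [show Real.pi - Real.pi / 2 = Real.pi / 2 by ring, zero_sub] at this
      exact ((intervalIntegrable_iff_integrableOn_Ioc_of_le (by linarith)).1 this).mono_set
        Ioo_subset_Ioc_self
    -- For σ < 0 Jordan's inequality cos x ≥ (2/π)(π/2 - |x|) bounds cos^σ by a power of the
    -- distance to the nearer endpoint; adding both powers avoids splitting the interval.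
    refine Integrable.mono' ((h1.add h2).const_mul ((2 / Real.pi) ^ σ)) hmeas ?_
    filter_upwards [self_mem_ae_restrict measurableSet_Ioo] with x hx
    have hcos := Real.cos_pos_of_mem_Ioo hx
    rw [Real.norm_eq_abs, abs_of_pos (Real.exp_pos _), mul_comm σ, ← Real.rpow_def_of_pos hcos]
    have hp1 : 0 < Real.pi / 2 - x := by linarith [hx.2]
    have hp2 : 0 < x + Real.pi / 2 := by linarith [hx.1]
    have hc : 0 < 2 / Real.pi := by positivity
    simp only [Pi.add_apply]
    rw [mul_add, ← Real.mul_rpow hc.le hp1.le, ← Real.mul_rpow hc.le hp2.le]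
    rcases le_total 0 x with h | h
    · have hle : 2 / Real.pi * (Real.pi / 2 - x) ≤ Real.cos x := by
        have := Real.one_sub_mul_le_cos h hx.2.le
        rw [mul_sub, show 2 / Real.pi * (Real.pi / 2) = 1 by field_simp]
        exact this
      have := Real.rpow_le_rpow_of_nonpos (by positivity) hle h0.le
      have h3 : 0 ≤ (2 / Real.pi * (x + Real.pi / 2)) ^ σ := by positivity
      linarith
    · have hle : 2 / Real.pi * (x + Real.pi / 2) ≤ Real.cos x := by
        have := Real.one_add_mul_le_cos hx.1.le h
        rw [mul_add, show 2 / Real.pi * (Real.pi / 2) = 1 by field_simp, add_comm]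
        exact this
      have := Real.rpow_le_rpow_of_nonpos (by positivity) hle h0.le
      have h3 : 0 ≤ (2 / Real.pi * (Real.pi / 2 - x)) ^ σ := by positivity
      linarith

theorem continuous_primCos {α : ℝ} (hα : 0 < α) : Continuous (primCos α) :=
  continuous_iff_continuousAt.2 fun x => (hasDerivAt_primCos hα x).continuousAt

theorem continuous_primCosh (α : ℝ) : Continuous (primCosh α) :=
  continuous_iff_continuousAt.2 fun x => (hasDerivAt_primCosh α x).continuousAt

theorem continuous_divPow_primCos {α : ℝ} (hα : 0 < α) (j : ℤ) :
    Continuous fun x => divPow (primCos α x) j :=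
  (continuous_divPow j).comp (Complex.continuous_ofReal.comp (continuous_primCos hα))

theorem integrable_cos_divPow {α : ℝ} (hα : 0 < α) {w : ℂ} (hw : -1 < w.re) (j : ℤ) :
    Integrable (fun x : ℝ => Complex.exp (w * Real.log (Real.cos x)) * divPow (primCos α x) j)
      (volume.restrict (Ioo (-(Real.pi / 2)) (Real.pi / 2))) := by
  have hcont := continuous_divPow_primCos hα j
  obtain ⟨M, hM⟩ := (isCompact_Icc (a := -(Real.pi / 2)) (b := Real.pi / 2)).exists_bound_of_continuousOn
    hcont.continuousOn
  refine Integrable.mono' ((integrableOn_exp_mul_log_cos hw).mul_const M) ?_ ?_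
  · refine AEStronglyMeasurable.mul ?_ hcont.aestronglyMeasurable
    exact (Complex.measurable_exp.comp ((Complex.measurable_ofReal.comp
      (Real.measurable_log.comp Real.measurable_cos)).const_mul w)).aestronglyMeasurable
  · filter_upwards [self_mem_ae_restrict measurableSet_Ioo] with x hx
    rw [norm_mul, norm_exp_mul_log]
    gcongr
    exact hM x (Ioo_subset_Icc_self hx)

theorem differentiableOn_cosIntegral {α : ℝ} (hα : 0 < α) (j : ℤ) :
    DifferentiableOn ℂ (fun w => cosIntegral α w j) {w | -1 < w.re} :=
  differentiableOn_integral_exp (U := Ioi (-1)) isOpen_Ioi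
    (Real.measurable_log.comp Real.measurable_cos).aestronglyMeasurable
    fun _ hw => integrable_cos_divPow hα hw j

theorem log_cosh_le (y : ℝ) : Real.log (Real.cosh y) ≤ |y| := by
  rw [← Real.cosh_abs, Real.log_le_iff_le_exp (Real.cosh_pos _), Real.cosh_eq]
  have : Real.exp (-|y|) ≤ Real.exp |y| := Real.exp_le_exp.2 (by linarith [abs_nonneg y])
  linarith

theorem le_log_cosh (y : ℝ) : |y| - Real.log 2 ≤ Real.log (Real.cosh y) := by
  rw [← Real.cosh_abs, Real.le_log_iff_exp_le (Real.cosh_pos _), Real.exp_sub,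
    Real.exp_log two_pos, Real.cosh_eq]
  linarith [Real.exp_pos (-|y|)]

theorem log_cosh_nonneg (y : ℝ) : 0 ≤ Real.log (Real.cosh y) :=
  Real.log_nonneg (Real.one_le_cosh y)

theorem tendsto_log_cosh_cocompact :
    Tendsto (fun y => Real.log (Real.cosh y)) (cocompact ℝ) atTop := by
  refine tendsto_atTop_mono le_log_cosh ?_
  exact tendsto_atTop_add_const_right _ _ (tendsto_norm_cocompact_atTop (E := ℝ))

theorem integrable_exp_mul_log_cosh {σ : ℝ} (hσ : σ < 0) :
    Integrable fun y => Real.exp (σ * Real.log (Real.cosh y)) := by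
  have hlogc : Continuous fun y => Real.log (Real.cosh y) :=
    Real.continuous_cosh.log fun y => (Real.cosh_pos y).ne'
  have hcont : Continuous fun y => Real.exp (σ * Real.log (Real.cosh y)) := by fun_prop
  have hb : ∀ y, Real.exp (σ * Real.log (Real.cosh y)) ≤
      Real.exp (-σ * Real.log 2) * Real.exp (σ * |y|) := by
    intro y
    rw [← Real.exp_add, Real.exp_le_exp]
    nlinarith [le_log_cosh y]
  have h1 : IntegrableOn (fun y => Real.exp (σ * Real.log (Real.cosh y))) (Ioi 0) := by
    refine Integrable.mono' ((integrableOn_exp_mul_Ioi hσ 0).const_mul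
      (Real.exp (-σ * Real.log 2))) hcont.aestronglyMeasurable ?_
    filter_upwards [self_mem_ae_restrict measurableSet_Ioi] with y hy
    rw [Real.norm_eq_abs, abs_of_pos (Real.exp_pos _)]
    simpa [abs_of_pos (mem_Ioi.1 hy)] using hb y
  have h2 : IntegrableOn (fun y => Real.exp (σ * Real.log (Real.cosh y))) (Iic 0) := by
    refine Integrable.mono' ((integrableOn_exp_mul_Iic (a := -σ) (by linarith) 0).const_mul
      (Real.exp (-σ * Real.log 2))) hcont.aestronglyMeasurable ?_
    filter_upwards [self_mem_ae_restrict measurableSet_Iic] with y hy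
    rw [Real.norm_eq_abs, abs_of_pos (Real.exp_pos _)]
    simpa [abs_of_nonpos (mem_Iic.1 hy)] using hb y
  rw [← integrableOn_univ, ← Iic_union_Ioi (a := (0 : ℝ))]
  exact h2.union h1

/-- Since cosh u ≤ e^|u|, the primitive is O(e^(α|y|)), and e^|y| ≤ 2 cosh y converts this back.
Hence F^j costs cosh^(αj), which explains the condition Re w < -αj for convergence of
`coshIntegral`. -/
theorem exists_norm_primCosh_le {α : ℝ} (hα : 0 < α) :
    ∃ C, 0 ≤ C ∧ ∀ y, ‖primCosh α y‖ ≤ C * Real.exp (α * Real.log (Real.cosh y)) := by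
  set h : ℝ → ℝ := fun y => ∫ u in (0 : ℝ)..y, Real.cosh u ^ α with hh
  have hodd : ∀ y, h (-y) = -h y := by
    intro y
    have := intervalIntegral.integral_comp_neg (a := 0) (b := y) (fun u => Real.cosh u ^ α)
    simp only [Real.cosh_neg, neg_zero] at this
    simp only [hh]
    rw [this, intervalIntegral.integral_symm]
  have hpos : ∀ y, 0 ≤ y → |h y| ≤ Real.exp (α * y) / α := by
    intro y hy
    rw [abs_of_nonneg (intervalIntegral.integral_nonneg hy fun u _ =>
      Real.rpow_nonneg (Real.cosh_pos u).le _)]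
    have h1 : h y ≤ ∫ u in (0 : ℝ)..y, Real.exp (α * u) := by
      refine intervalIntegral.integral_mono_on hy
        ((continuous_cosh_rpow α).intervalIntegrable _ _)
        (Continuous.intervalIntegrable (by fun_prop) _ _) fun u hu => ?_
      rw [Real.rpow_def_of_pos (Real.cosh_pos u), Real.exp_le_exp, mul_comm]
      have := log_cosh_le u
      rw [abs_of_nonneg hu.1] at this
      gcongr
    have h2 : ∫ u in (0 : ℝ)..y, Real.exp (α * u) = (Real.exp (α * y) - 1) / α := by
      rw [intervalIntegral.integral_comp_mul_left (fun u => Real.exp u) hα.ne', integral_exp]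
      simp [div_eq_inv_mul]
    rw [h2] at h1
    refine h1.trans ?_
    gcongr
    linarith
  have hall : ∀ y, |h y| ≤ Real.exp (α * |y|) / α := by
    intro y
    rcases le_total 0 y with hy | hy
    · simpa [abs_of_nonneg hy] using hpos y hy
    · have := hpos (-y) (by linarith)
      rwa [hodd, abs_neg, ← abs_of_nonpos hy] at this
  refine ⟨|primCos α 0| + Real.exp (α * Real.log 2) / α, by positivity, fun y => ?_⟩
  have he : 1 ≤ Real.exp (α * Real.log (Real.cosh y)) :=
    Real.one_le_exp (mul_nonneg hα.le (log_cosh_nonneg y))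
  calc ‖primCosh α y‖ ≤ |primCos α 0| + |h y| := by
        refine (norm_add_le _ _).trans ?_
        rw [norm_mul, Complex.norm_I, one_mul, Complex.norm_real, Complex.norm_real]
        rfl
    _ ≤ |primCos α 0| * Real.exp (α * Real.log (Real.cosh y)) +
        Real.exp (α * Real.log 2) / α * Real.exp (α * Real.log (Real.cosh y)) := by
        gcongr
        · exact le_mul_of_one_le_right (abs_nonneg _) he
        · refine (hall y).trans ?_
          rw [div_mul_eq_mul_div, ← Real.exp_add, ← mul_add]
          gcongr
          linarith [le_log_cosh y]
    _ = _ := by ring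

theorem exists_norm_divPow_primCosh_le {α : ℝ} (hα : 0 < α) (j : ℤ) :
    ∃ C, 0 ≤ C ∧ ∀ y, ‖divPow (primCosh α y) j‖ ≤ C * Real.exp (α * j * Real.log (Real.cosh y)) := by
  obtain ⟨C, hC, hb⟩ := exists_norm_primCosh_le hα
  rcases lt_or_ge j 0 with hj | hj
  · exact ⟨0, le_rfl, fun y => by simp [divPow_of_neg _ hj]⟩
  · refine ⟨C ^ j.toNat, by positivity, fun y => (norm_divPow_le _ _).trans ?_⟩
    calc ‖primCosh α y‖ ^ j.toNat ≤ (C * Real.exp (α * Real.log (Real.cosh y))) ^ j.toNat := by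
          gcongr
          exact hb y
      _ = _ := by
          rw [mul_pow, ← Real.exp_nat_mul]
          have : ((j.toNat : ℕ) : ℝ) = (j : ℝ) := by exact_mod_cast Int.toNat_of_nonneg hj
          rw [this]
          ring_nf

theorem continuous_log_cosh : Continuous fun y => Real.log (Real.cosh y) :=
  Real.continuous_cosh.log fun y => (Real.cosh_pos y).ne'

theorem integrable_cosh_divPow {α : ℝ} (hα : 0 < α) {w : ℂ} {j : ℤ} (hw : w.re < -(α * j)) :
    Integrable fun y : ℝ =>
      Complex.exp (w * Real.log (Real.cosh y)) * (divPow (primCosh α y) j * Complex.I) := by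
  obtain ⟨C, hC, hb⟩ := exists_norm_divPow_primCosh_le hα j
  have hlog := continuous_log_cosh
  have hF := continuous_primCosh α
  have hdp := continuous_divPow j
  refine Integrable.mono' ((integrable_exp_mul_log_cosh (σ := w.re + α * j) (by linarith)).const_mul C)
    (Continuous.aestronglyMeasurable (by fun_prop)) (Eventually.of_forall fun y => ?_)
  rw [norm_mul, norm_mul, Complex.norm_I, mul_one, norm_exp_mul_log, add_mul, Real.exp_add,
    mul_left_comm]
  gcongr
  exact hb y

theorem differentiableOn_coshIntegral {α : ℝ} (hα : 0 < α) (j : ℤ) :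
    DifferentiableOn ℂ (fun w => coshIntegral α w j) {w | w.re < -(α * j)} :=
  differentiableOn_integral_exp (U := Iio (-(α * j))) isOpen_Iio
    continuous_log_cosh.aestronglyMeasurable fun _ hw => integrable_cosh_divPow hα hw

/-! ### The common three-term recurrence. -/

theorem integral_recurrence_combination {μ : Measure ℝ} {u v z : ℝ → ℂ} {a b c : ℂ}
    (hu : Integrable u μ) (hv : Integrable v μ) (hz : Integrable z μ) :
    Integrable (fun t => a * u t - b * v t + z t / c) μ ∧
      ∫ t, (a * u t - b * v t + z t / c) ∂μ =
        a * ∫ t, u t ∂μ - b * ∫ t, v t ∂μ + (∫ t, z t ∂μ) / c := by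
  have h1 := hu.const_mul a
  have h2 := hv.const_mul b
  have h3 := hz.div_const c
  refine ⟨(h1.sub h2).add h3, ?_⟩
  have h4 := integral_add (h1.sub h2) h3
  simp only [Pi.sub_apply] at h4
  rw [h4, integral_sub h1 h2, integral_const_mul, integral_const_mul,
    integral_div]

/-- Integrate the derivative from `hasDerivAt_primitive` with ω = i over the whole line; the
hypothesis on w is what makes the term with exponent w + 1 converge and the boundary values vanish.
-/
theorem coshIntegral_recurrence {α : ℝ} (hα : 0 < α) {w : ℂ} {j : ℤ}
    (hw : w.re + 1 < -(α * j)) :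
    (1 + w) * coshIntegral α (w + 1) j - w * coshIntegral α (w - 1) j +
      coshIntegral α (w + 2 * α + 1) (j - 2) / (w + α + 1) = 0 := by
  -- For j ≥ 1 convergence forces Re(w + α + 1) < α - αj ≤ 0.
  have hne : w + α + 1 ≠ 0 ∨ j ≤ 0 := by
    by_contra! h
    have h1 : w.re + α + 1 = 0 := by simpa using congrArg Complex.re h.1
    have h2 : (1 : ℝ) ≤ j := by exact_mod_cast h.2
    nlinarith
  have hderiv : ∀ t : ℝ, _ := fun t =>
    hasDerivAt_primitive (c := Real.cosh) (s := fun t => Complex.I * Real.sinh t)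
      (f := primCosh α) (ω := Complex.I) (w := w) (α := α) (c' := Real.sinh t) (t := t) (j := j)
      (Real.cosh_pos t) (Real.hasDerivAt_cosh t)
      (by linear_combination (Real.sinh t : ℂ) * Complex.I_mul_I)
      ((Real.hasDerivAt_sinh t).ofReal_comp.const_mul _)
      ((hasDerivAt_primCosh α t).congr_deriv (by rw [exp_ofReal_mul_log (Real.cosh_pos t)]))
      (by
        have := Real.cosh_sq t
        have h2 : (Real.cosh t : ℂ) ^ 2 = (Real.sinh t : ℂ) ^ 2 + 1 := by exact_mod_cast this
        linear_combination h2 + (Real.sinh t : ℂ) ^ 2 * Complex.I_sq) hne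
  obtain ⟨hint, heq⟩ := integral_recurrence_combination (a := 1 + w) (b := w) (c := w + α + 1)
    (integrable_cosh_divPow hα (w := w + 1) (j := j) (by simpa using hw))
    (integrable_cosh_divPow hα (w := w - 1) (j := j)
      (by simp only [Complex.sub_re, Complex.one_re]; linarith))
    (integrable_cosh_divPow hα (w := w + 2 * α + 1) (j := j - 2) (by
      simp only [Complex.add_re, Complex.mul_re, Complex.ofReal_re, Complex.one_re]
      push_cast
      simp
      linarith))
  have hlim : Tendsto (fun t : ℝ => Complex.exp (w * Real.log (Real.cosh t)) *
      (Complex.I * Real.sinh t) * divPow (primCosh α t) j +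
        Complex.exp ((w + α + 1) * Real.log (Real.cosh t)) * divPow (primCosh α t) (j - 1) /
          (w + α + 1)) (cocompact ℝ) (𝓝 0) := by
    obtain ⟨C, hC, hb⟩ := exists_norm_divPow_primCosh_le hα j
    obtain ⟨C', hC', hb'⟩ := exists_norm_divPow_primCosh_le hα (j - 1)
    -- Both boundary terms are O(cosh^σ): the first contributes w, 1 (from sinh) and αj, the second
    -- w + α + 1 and α(j - 1).
    set σ := w.re + 1 + α * j with hσ
    have hexp : Tendsto (fun t : ℝ => Real.exp (σ * Real.log (Real.cosh t))) (cocompact ℝ)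
        (𝓝 0) := by
      refine Real.tendsto_exp_atBot.comp ?_
      exact tendsto_log_cosh_cocompact.const_mul_atTop_of_neg (by linarith)
    refine squeeze_zero_norm (a := fun t : ℝ => (C + C' / ‖w + α + 1‖) *
      Real.exp (σ * Real.log (Real.cosh t))) (fun t => ?_) (by simpa using hexp.const_mul _)
    refine (norm_add_le _ _).trans ?_
    rw [add_mul C]
    have hs : ‖(Real.sinh t : ℂ)‖ ≤ Real.exp (Real.log (Real.cosh t)) := by
      rw [Complex.norm_real, Real.exp_log (Real.cosh_pos t), Real.norm_eq_abs, Real.abs_sinh,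
        ← Real.cosh_abs t]
      exact (Real.sinh_lt_cosh _).le
    apply add_le_add
    · rw [norm_mul, norm_mul, norm_mul, Complex.norm_I, one_mul, norm_exp_mul_log]
      calc _ ≤ Real.exp (w.re * Real.log (Real.cosh t)) * Real.exp (Real.log (Real.cosh t)) *
            (C * Real.exp (α * j * Real.log (Real.cosh t))) := by
            gcongr
            exact hb t
        _ = _ := by
            rw [hσ, add_mul, add_mul, one_mul, Real.exp_add, Real.exp_add]
            ring
    · rw [norm_div, norm_mul, norm_exp_mul_log, div_mul_eq_mul_div]
      refine div_le_div_of_nonneg_right ?_ (norm_nonneg _)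
      calc _ ≤ Real.exp ((w + α + 1).re * Real.log (Real.cosh t)) *
            (C' * Real.exp (α * (j - 1 : ℤ) * Real.log (Real.cosh t))) := by
            gcongr
            exact hb' t
        _ = _ := by
            rw [mul_left_comm, ← Real.exp_add, ← add_mul]
            congr 3
            simp only [Complex.add_re, Complex.ofReal_re, Complex.one_re]
            push_cast
            rw [hσ]
            ring
  have hfin := integral_of_hasDerivAt_of_tendsto hderiv hint
    (hlim.mono_left atBot_le_cocompact) (hlim.mono_left atTop_le_cocompact)
  rw [heq, sub_zero] at hfin
  exact hfin

/-- The same derivative with ω = 1; Re w > 0 gives convergence of the term with exponent w - 1 and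
makes cos^w vanish at ±π/2. -/
theorem cosIntegral_recurrence {α : ℝ} (hα : 0 < α) {w : ℂ} (j : ℤ) (hw : 0 < w.re) :
    (1 + w) * cosIntegral α (w + 1) j - w * cosIntegral α (w - 1) j +
      cosIntegral α (w + 2 * α + 1) (j - 2) / (w + α + 1) = 0 := by
  have hpi := Real.pi_pos
  have hne : w + α + 1 ≠ 0 ∨ j ≤ 0 := by
    left
    intro h
    have h1 : w.re + α + 1 = 0 := by simpa using congrArg Complex.re h
    linarith
  have hderiv : ∀ t ∈ Ioo (-(Real.pi / 2)) (Real.pi / 2), _ := fun t ht =>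
    hasDerivAt_primitive (c := Real.cos) (s := fun t => Real.sin t)
      (f := fun t => primCos α t) (ω := 1) (w := w) (α := α) (c' := -Real.sin t) (t := t) (j := j)
      (Real.cos_pos_of_mem_Ioo ht) (Real.hasDerivAt_cos t) (by push_cast; ring)
      ((Real.hasDerivAt_sin t).ofReal_comp.congr_deriv (by push_cast; ring))
      ((hasDerivAt_primCos hα t).ofReal_comp.congr_deriv
        (by rw [exp_ofReal_mul_log (Real.cos_pos_of_mem_Ioo ht), one_mul]))
      (by exact_mod_cast Real.cos_sq_add_sin_sq t) hne
  simp only [mul_one] at hderiv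
  obtain ⟨hint, heq⟩ := integral_recurrence_combination (a := 1 + w) (b := w) (c := w + α + 1)
    (integrable_cos_divPow hα (w := w + 1)
      (by simp only [Complex.add_re, Complex.one_re]; linarith) j)
    (integrable_cos_divPow hα (w := w - 1)
      (by simp only [Complex.sub_re, Complex.one_re]; linarith) j)
    (integrable_cos_divPow hα (w := w + 2 * α + 1) (by
      simp
      linarith) (j - 2))
  -- Stated for a general filter so that both one-sided limits, at -π/2 and at π/2, are instances.
  have hlim : ∀ l : Filter ℝ, l ≤ 𝓟 (Ioo (-(Real.pi / 2)) (Real.pi / 2)) →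
      ∀ a : ℝ, l ≤ 𝓝 a → Real.cos a = 0 →
      Tendsto (fun t : ℝ => Complex.exp (w * Real.log (Real.cos t)) *
        (Real.sin t) * divPow (primCos α t) j +
          Complex.exp ((w + α + 1) * Real.log (Real.cos t)) * divPow (primCos α t) (j - 1) /
            (w + α + 1)) l (𝓝 0) := by
    intro l hl a ha hcos
    have hlog : Tendsto (fun t => Real.log (Real.cos t)) l atBot := by
      refine Real.tendsto_log_nhdsGT_zero.comp (tendsto_nhdsWithin_iff.2 ⟨?_, ?_⟩)
      · rw [← hcos]
        exact (Real.continuous_cos.tendsto a).mono_left ha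
      · filter_upwards [le_principal_iff.1 hl] with t ht
        exact Real.cos_pos_of_mem_Ioo ht
    have hexp : ∀ v : ℂ, 0 < v.re →
        Tendsto (fun t : ℝ => Complex.exp (v * Real.log (Real.cos t))) l (𝓝 0) := by
      intro v hv
      rw [tendsto_zero_iff_norm_tendsto_zero]
      simp only [norm_exp_mul_log]
      exact Real.tendsto_exp_atBot.comp (hlog.const_mul_atBot hv)
    have hsin : Tendsto (fun t : ℝ => (Real.sin t : ℂ)) l (𝓝 (Real.sin a)) :=
      ((Complex.continuous_ofReal.comp Real.continuous_sin).tendsto a).mono_left ha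
    have hdp : ∀ i : ℤ, Tendsto (fun t : ℝ => divPow (primCos α t) i) l
        (𝓝 (divPow (primCos α a) i)) := fun i =>
      ((continuous_divPow_primCos hα i).tendsto a).mono_left ha
    have h1 := ((hexp w hw).mul hsin).mul (hdp j)
    have h2 := ((hexp (w + α + 1) (by simp; linarith)).mul (hdp (j - 1))).div_const (w + α + 1)
    simpa using h1.add h2
  have hfin := intervalIntegral.integral_eq_sub_of_hasDerivAt_of_tendsto (by linarith) hderiv
    ((intervalIntegrable_iff_integrableOn_Ioo_of_le (by linarith)).2 hint)
    (hlim _ (le_principal_iff.2 (Ioo_mem_nhdsGT (by linarith))) (-(Real.pi / 2))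
      nhdsWithin_le_nhds (by simp))
    (hlim _ (le_principal_iff.2 (Ioo_mem_nhdsLT (by linarith))) (Real.pi / 2)
      nhdsWithin_le_nhds (by simp))
  rw [intervalIntegral.integral_of_le (by linarith), integral_Ioc_eq_integral_Ioo, heq,
    sub_zero] at hfin
  exact hfin

/-! ### Meromorphic continuation of the integrals and of A and B. -/

theorem Meromorphic.comp_entire {f g : ℂ → ℂ} (hf : Meromorphic f) (hg : Differentiable ℂ g) :
    Meromorphic fun z => f (g z) := fun z =>
  (hf (g z)).comp_analyticAt (hg.analyticAt z)

theorem cosIntegral_of_neg (α : ℝ) (w : ℂ) {j : ℤ} (hj : j < 0) : cosIntegral α w j = 0 := by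
  simp [cosIntegral, divPow_of_neg _ hj]

theorem coshIntegral_of_neg (α : ℝ) (w : ℂ) {j : ℤ} (hj : j < 0) : coshIntegral α w j = 0 := by
  simp [coshIntegral, divPow_of_neg _ hj]

/-- The recurrence expresses the value at z through the value at z + 2 and a term of index j - 2.
Induction on j in steps of two, starting from negative j where everything is zero, makes that
inhomogeneous term meromorphic. -/
theorem exists_meromorphic_cosIntegral {α : ℝ} (hα : 0 < α) (j : ℤ) :
    ∃ g : ℂ → ℂ, Meromorphic g ∧ ∀ z : ℂ, -1 < z.re → g z = cosIntegral α z j := by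
  suffices h : ∀ n : ℕ, ∀ j : ℤ, j < 2 * n →
      ∃ g : ℂ → ℂ, Meromorphic g ∧ ∀ z : ℂ, -1 < z.re → g z = cosIntegral α z j from
    h (j.toNat + 1) j (by omega)
  intro n
  induction n with
  | zero =>
    intro j hj
    exact ⟨fun _ => 0, Meromorphic.const 0, fun z _ =>
      (cosIntegral_of_neg α z (by simpa using hj)).symm⟩
  | succ n ih =>
    intro j hj
    obtain ⟨g, hg, hgeq⟩ := ih (j - 2) (by push_cast at hj; omega)
    have hg' : Meromorphic fun z => g (z + 2 * α + 2) := Meromorphic.comp_entire hg (by fun_prop)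
    have hlin : ∀ a : ℂ, Meromorphic fun z : ℂ => z + a := fun a z =>
      AnalyticAt.meromorphicAt (by fun_prop)
    refine exists_meromorphic_extension (δ := 2) two_pos (differentiableOn_cosIntegral hα j)
      (R := fun z => (z + 2) / (z + 1)) (S := fun z => g (z + 2 * α + 2) / (z + (α + 2)) / (z + 1))
      ((hlin 2).div (hlin 1)) ((hg'.div (hlin _)).div (hlin 1)) fun z hz => ?_
    have hrec := cosIntegral_recurrence hα (w := z + 1) j
      (by simp only [Complex.add_re, Complex.one_re]; linarith)
    have h1 : z + 1 ≠ 0 := fun h => by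
      have : z.re + 1 = 0 := by simpa using congrArg Complex.re h
      linarith
    rw [hgeq _ (by simp; linarith)]
    rw [show z + 1 + 1 = z + 2 by ring, show z + 1 - 1 = z by ring,
      show z + 1 + 2 * α + 1 = z + 2 * α + 2 by ring,
      show z + 1 + α + 1 = z + (α + 2) by ring] at hrec
    rw [show ((2 : ℝ) : ℂ) = 2 by norm_num, div_mul_eq_mul_div, ← add_div, eq_div_iff h1]
    linear_combination -hrec

/-- Same induction; the sign change z = -w turns the half-plane of convergence into a right
half-plane. -/
theorem exists_meromorphic_coshIntegral {α : ℝ} (hα : 0 < α) (j : ℤ) :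
    ∃ g : ℂ → ℂ, Meromorphic g ∧ ∀ z : ℂ, α * j < z.re → g z = coshIntegral α (-z) j := by
  suffices h : ∀ n : ℕ, ∀ j : ℤ, j < 2 * n →
      ∃ g : ℂ → ℂ, Meromorphic g ∧ ∀ z : ℂ, α * j < z.re → g z = coshIntegral α (-z) j from
    h (j.toNat + 1) j (by omega)
  intro n
  induction n with
  | zero =>
    intro j hj
    exact ⟨fun _ => 0, Meromorphic.const 0, fun z _ =>
      (coshIntegral_of_neg α _ (by simpa using hj)).symm⟩
  | succ n ih =>
    intro j hj
    -- Solving the recurrence divides by z, which is nonzero on Re z > αj only once j ≥ 0 is known.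
    rcases lt_or_ge j 0 with hneg | hnonneg
    · exact ⟨fun _ => 0, Meromorphic.const 0, fun z _ => (coshIntegral_of_neg α _ hneg).symm⟩
    obtain ⟨g, hg, hgeq⟩ := ih (j - 2) (by push_cast at hj; omega)
    have hg' : Meromorphic fun z => g (z - 2 * α) := Meromorphic.comp_entire hg (by fun_prop)
    have hlin : ∀ a b : ℂ, Meromorphic fun z : ℂ => a * z + b := fun a b z =>
      AnalyticAt.meromorphicAt (by fun_prop)
    have hdiff : DifferentiableOn ℂ (fun z => coshIntegral α (-z) j) {z | α * j < z.re} :=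
      (differentiableOn_coshIntegral hα j).comp (f := fun z : ℂ => -z) (by fun_prop)
        fun z hz => by
          simp only [mem_ofPred_eq, Complex.neg_re, neg_lt_neg_iff] at hz ⊢
          exact hz
    refine exists_meromorphic_extension (δ := 2) two_pos hdiff
      (R := fun z => (1 * z + 1) / (1 * z + 0))
      (S := fun z => g (z - 2 * α) / (-1 * z + α) / (1 * z + 0))
      ((hlin 1 1).div (hlin 1 0)) ((hg'.div (hlin _ _)).div (hlin 1 0)) fun z hz => ?_
    have hrec := coshIntegral_recurrence hα (w := -z - 1) (j := j)
      (by simp only [Complex.sub_re, Complex.neg_re, Complex.one_re]; linarith)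
    have h1 : 1 * z + 0 ≠ 0 := fun h => by
      have h2 : z.re = 0 := by simpa using congrArg Complex.re h
      have h3 : (0 : ℝ) ≤ j := by exact_mod_cast hnonneg
      have := mul_nonneg hα.le h3
      linarith
    rw [hgeq _ (by push_cast; simp; linarith)]
    rw [show -z - 1 + 1 = -z by ring, show -z - 1 - 1 = -(z + 2) by ring,
      show -z - 1 + 2 * α + 1 = -(z - 2 * α) by ring,
      show -z - 1 + α + 1 = -1 * z + α by ring] at hrec
    rw [show ((2 : ℝ) : ℂ) = 2 by norm_num, div_mul_eq_mul_div, ← add_div, eq_div_iff h1]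
    linear_combination -hrec

theorem meromorphicContinuation_integralA {α : ℝ} (hα : 0 < α) (j : ℕ) :
    Meromorphic (meromorphicContinuation (integralA α j) {z | 0 < z.re}) ∧
      EqOn (meromorphicContinuation (integralA α j) {z | 0 < z.re}) (integralA α j)
        {z | 0 < z.re} := by
  obtain ⟨g, hg, hgeq⟩ := exists_meromorphic_coshIntegral hα j
  have hre : ∀ κ : ℂ, 0 < κ.re → α * ((j : ℤ) : ℝ) < (α * (κ + j)).re := fun κ hκ => by
    simp
    nlinarith
  have hopen : IsOpen {z : ℂ | 0 < z.re} := isOpen_lt continuous_const Complex.continuous_re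
  have hΓ : Meromorphic fun κ : ℂ => Complex.Gamma (κ + j + 1) :=
    Meromorphic.comp_entire Meromorphic.Gamma (by fun_prop)
  refine meromorphicContinuation_spec (g := fun κ => (α : ℂ) ^ (j + 1) *
    (Complex.Gamma (κ + j + 1) / (2 * Real.pi * Complex.I)) * g (α * (κ + j))) hopen ?_ ?_ ?_
  · have : integralA α j = fun κ => (α : ℂ) ^ (j + 1) *
        (Complex.Gamma (κ + j + 1) / (2 * Real.pi * Complex.I)) *
        coshIntegral α (-(α * (κ + j))) j := funext (integralA_eq α j)
    rw [this]
    have h1 : DifferentiableOn ℂ (fun κ : ℂ => Complex.Gamma (κ + j + 1)) {z | 0 < z.re} := by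
      intro κ hκ
      apply DifferentiableAt.differentiableWithinAt
      refine (Complex.differentiableAt_Gamma (κ + j + 1) fun m h => ?_).comp κ
        (f := fun κ : ℂ => κ + j + 1) (by fun_prop)
      have h2 : κ.re + j + 1 = -(m : ℝ) := by simpa using congrArg Complex.re h
      have h3 : (0 : ℝ) ≤ m := m.cast_nonneg
      have h4 : (0 : ℝ) ≤ j := j.cast_nonneg
      simp only [mem_ofPred_eq] at hκ
      linarith
    have h2 : DifferentiableOn ℂ (fun κ : ℂ => coshIntegral α (-(α * (κ + j))) j)
        {z | 0 < z.re} :=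
      (differentiableOn_coshIntegral hα j).comp (f := fun κ : ℂ => -(α * (κ + j))) (by fun_prop)
        fun κ hκ => by
          have := hre κ hκ
          rw [mem_ofPred_eq, Complex.neg_re]
          linarith
    exact ((h1.div_const _).const_mul _).mul h2
  · have h3 : Meromorphic fun κ : ℂ => g (α * (κ + j)) := Meromorphic.comp_entire hg (by fun_prop)
    exact ((Meromorphic.const _).mul (hΓ.div (Meromorphic.const _))).mul h3
  · intro κ hκ
    simp only
    rw [integralA_eq, hgeq _ (hre κ hκ)]

theorem meromorphicContinuation_integralB {α : ℝ} (hα : 0 < α) (j : ℕ) :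
    Meromorphic (meromorphicContinuation (integralB α j) {z | -(1 / α) < z.re}) ∧
      EqOn (meromorphicContinuation (integralB α j) {z | -(1 / α) < z.re}) (integralB α j)
        {z | -(1 / α) < z.re} := by
  obtain ⟨g, hg, hgeq⟩ := exists_meromorphic_cosIntegral hα j
  have hre : ∀ κ : ℂ, -(1 / α) < κ.re → -1 < (α * κ).re := fun κ hκ => by
    rw [Complex.re_ofReal_mul]
    calc (-1 : ℝ) = α * (-(1 / α)) := by field_simp
      _ < α * κ.re := by gcongr
  have hopen : IsOpen {z : ℂ | -(1 / α) < z.re} :=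
    isOpen_lt continuous_const Complex.continuous_re
  refine meromorphicContinuation_spec (g := fun κ => (α : ℂ) ^ j * (Complex.Gamma κ)⁻¹ * g (α * κ))
    hopen ?_ ?_ ?_
  · have : integralB α j = fun κ => (α : ℂ) ^ j * (Complex.Gamma κ)⁻¹ *
        cosIntegral α (α * κ) j := funext (integralB_eq hα j)
    rw [this]
    have h2 : DifferentiableOn ℂ (fun κ : ℂ => cosIntegral α (α * κ) j) {z | -(1 / α) < z.re} :=
      (differentiableOn_cosIntegral hα j).comp (f := fun κ : ℂ => α * κ) (by fun_prop)
        fun κ hκ => hre κ hκ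
    exact (Complex.differentiable_one_div_Gamma.differentiableOn.const_mul _).mul h2
  · have h3 : Meromorphic fun κ : ℂ => g (α * κ) := Meromorphic.comp_entire hg (by fun_prop)
    exact ((Meromorphic.const _).mul Meromorphic.Gamma.inv).mul h3
  · intro κ hκ
    simp only
    rw [integralB_eq hα, hgeq _ (hre κ hκ)]

/-- `A[κ + j, κ]` as a function of `κ`. -/
def extA (α : ℝ) (j : ℕ) : ℂ → ℂ := meromorphicContinuation (integralA α j) {z | 0 < z.re}

/-- `B{κ + j, κ}` as a function of `κ`. -/
def extB (α : ℝ) (j : ℕ) : ℂ → ℂ := meromorphicContinuation (integralB α j) {z | -(1 / α) < z.re}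

theorem A_eq_extA (α : ℝ) {ν κ : ℂ} {j : ℕ} (h : ν - κ = j) : A α ν κ = extA α j κ := by
  have hex : ∃ j : ℕ, ν - κ = j := ⟨j, h⟩
  have hj : hex.choose = j := by exact_mod_cast hex.choose_spec.symm.trans h
  rw [A, dif_pos hex, hj, extA]

theorem B_eq_extB (α : ℝ) {ν κ : ℂ} {j : ℕ} (h : ν - κ = j) : B α ν κ = extB α j κ := by
  have hex : ∃ j : ℕ, ν - κ = j := ⟨j, h⟩
  have hj : hex.choose = j := by exact_mod_cast hex.choose_spec.symm.trans h
  rw [B, dif_pos hex, hj, extB]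

theorem extA_eq {α : ℝ} (hα : 0 < α) (j : ℕ) {κ : ℂ} (hκ : 0 < κ.re) :
    extA α j κ = (α : ℂ) ^ (j + 1) * (Complex.Gamma (κ + j + 1) / (2 * Real.pi * Complex.I)) *
      coshIntegral α (-(α * (κ + j))) j := by
  rw [extA, (meromorphicContinuation_integralA hα j).2 hκ, integralA_eq]

theorem extB_eq {α : ℝ} (hα : 0 < α) (j : ℕ) {κ : ℂ} (hκ : 0 < κ.re) :
    extB α j κ = (α : ℂ) ^ j * (Complex.Gamma κ)⁻¹ * cosIntegral α (α * κ) j := by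
  rw [extB, (meromorphicContinuation_integralB hα j).2, integralB_eq hα]
  rw [mem_ofPred_eq]
  have : 0 < 1 / α := by positivity
  linarith

/-! ### The ladder relations for the integrals. -/

/-- The middle terms of the ladder. -/
def ladderD (α : ℝ) (N K : ℤ) (m : ℂ) (s : ℤ) : ℂ :=
  m * cosIntegral α m (N - s) * coshIntegral α (-m) (K + s)

/-- The summands of the left-hand sides, up to a constant factor. -/
def ladderE (α : ℝ) (N K : ℤ) (m : ℂ) (s : ℤ) : ℂ :=
  (m + 1) * cosIntegral α m (N - s) * coshIntegral α (-(m + 2)) (K + s)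

/-- The correction terms of the ladder, which telescope. -/
def ladderG (α : ℝ) (N K : ℤ) (m : ℂ) (s : ℤ) : ℂ :=
  cosIntegral α (m + α) (N - s - 1) * coshIntegral α (-(m - α)) (K + s - 1) / m

/-- The recurrence for the `coshIntegral` factor at w = -m - 1, multiplied by the fixed
`cosIntegral` factor. -/
theorem ladderE_eq_left {α : ℝ} (hα : 0 < α) (N K : ℤ) {m : ℂ} {s : ℤ}
    (h : α * (K + s : ℤ) < m.re) :
    ladderE α N K m s = ladderD α N K m s + ladderG α N K (m - α) (s - 1) := by
  have hrec := coshIntegral_recurrence hα (w := -m - 1) (j := K + s)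
    (by simp only [Complex.sub_re, Complex.neg_re, Complex.one_re]; linarith)
  rw [show -m - 1 + 1 = -m by ring, show -m - 1 - 1 = -(m + 2) by ring,
    show -m - 1 + 2 * α + 1 = -(m - α - α) by ring,
    show -m - 1 + α + 1 = -(m - α) by ring, div_neg] at hrec
  rw [ladderE, ladderD, ladderG, show m - α + α = m by ring, show N - (s - 1) - 1 = N - s by ring,
    show K + (s - 1) - 1 = K + s - 2 by ring]
  linear_combination cosIntegral α m (N - s) * hrec

/-- The recurrence for the `cosIntegral` factor at w = m + 1, with the `coshIntegral` factor fixed.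
It produces the same G as `ladderE_eq_left`, which is what allows telescoping. -/
theorem ladderE_eq_right {α : ℝ} (hα : 0 < α) (N K : ℤ) {m : ℂ} {s : ℤ} (h : 0 < m.re) :
    ladderE α N K m s = ladderD α N K (m + 2) s + ladderG α N K (m + 2 + α) (s + 1) := by
  have hrec := cosIntegral_recurrence hα (w := m + 1) (N - s)
    (by simp only [Complex.add_re, Complex.one_re]; linarith)
  rw [show m + 1 + 1 = m + 2 by ring, show m + 1 - 1 = m by ring,
    show m + 1 + 2 * α + 1 = m + 2 + α + α by ring,
    show m + 1 + α + 1 = m + 2 + α by ring] at hrec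
  rw [ladderE, ladderD, ladderG, show m + 2 + α - α = m + 2 by ring,
    show N - (s + 1) - 1 = N - s - 2 by ring, show K + (s + 1) - 1 = K + s by ring]
  linear_combination -coshIntegral α (-(m + 2)) (K + s) * hrec

/-- The weight is designed so that Γ(m) cancels the 1/Γ(m) in B and 1/Γ(m+1+2/α) cancels the Gamma
factor of A; the spare power of α turns m + 1/α into e + 1. -/
theorem left_summand_eq {α : ℝ} (hα : 0 < α) (N K : ℤ) {i j : ℕ} {s : ℤ} (hi : (i : ℤ) = K + s)
    (hj : (j : ℤ) = N - s) {k m e : ℂ} (hm : m = k + i)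
    (he : e = α * m) (hk : 0 < k.re) :
    extB α j m * ((m + 1 / α) * Complex.Gamma m / Complex.Gamma (m + 1 + 2 / α)) *
      extA α i (k + 2 / α) =
      (α : ℂ) ^ (N + K) / (2 * Real.pi * Complex.I) * ladderE α N K e s := by
  subst he
  have hα0 : (α : ℂ) ≠ 0 := by exact_mod_cast hα.ne'
  have hmre : 0 < m.re := by
    have : (0 : ℝ) ≤ i := i.cast_nonneg
    rw [hm]; simp; linarith
  have h2 : (0 : ℝ) < 2 / α := by positivity
  have hcast : (2 / α : ℂ) = ((2 / α : ℝ) : ℂ) := by push_cast; rfl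
  have hk2 : 0 < (k + 2 / α : ℂ).re := by
    rw [hcast, Complex.add_re, Complex.ofReal_re]; linarith
  have hΓ1 : Complex.Gamma m ≠ 0 := Complex.Gamma_ne_zero_of_re_pos hmre
  have hΓ2 : Complex.Gamma (m + 1 + 2 / α) ≠ 0 := Complex.Gamma_ne_zero_of_re_pos (by
    rw [hcast, Complex.add_re, Complex.add_re, Complex.ofReal_re, Complex.one_re]; linarith)
  rw [extB_eq hα j hmre, extA_eq hα i hk2, ladderE, ← hi, ← hj,
    show N + K = ((i + j : ℕ) : ℤ) by push_cast; omega, zpow_natCast,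
    show k + 2 / α + i + 1 = m + 1 + 2 / α by rw [hm]; ring,
    show -(α * (k + 2 / α + i)) = -(α * m + 2) by rw [hm]; field_simp; ring]
  generalize Complex.Gamma (m + 1 + 2 / α) = γ at hΓ2 ⊢
  field_simp
  ring

/-- Here Γ(m+1)/Γ(m) = m, and the spare power of α turns it into e. The constant does not depend on
s and is the one of `left_summand_eq`. -/
theorem right_summand_eq {α : ℝ} (hα : 0 < α) (N K : ℤ) {i j : ℕ} {s : ℤ} (hi : (i : ℤ) = K + s)
    (hj : (j : ℤ) = N - s) {k m e : ℂ} (hm : m = k + i)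
    (he : e = α * m) (hk : 0 < k.re) :
    extB α j m * extA α i k =
      (α : ℂ) ^ (N + K) / (2 * Real.pi * Complex.I) * ladderD α N K e s := by
  subst he
  have hα0 : (α : ℂ) ≠ 0 := by exact_mod_cast hα.ne'
  have hmre : 0 < m.re := by
    have : (0 : ℝ) ≤ i := i.cast_nonneg
    rw [hm]; simp; linarith
  have hm0 : m ≠ 0 := fun h => by simp [h] at hmre
  have hΓ1 : Complex.Gamma m ≠ 0 := Complex.Gamma_ne_zero_of_re_pos hmre
  rw [extB_eq hα j hmre, extA_eq hα i hk, ladderD, ← hi, ← hj,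
    show N + K = ((i + j : ℕ) : ℤ) by push_cast; omega, zpow_natCast, ← hm,
    Complex.Gamma_add_one m hm0]
  field_simp
  ring

/-- The bound on Re e leaves room for K downward steps of length 2 while every integral met on the
way still converges. -/
theorem sum_ladder_nonpos {α : ℝ} (hα : 0 < α) (N : ℤ) (K : ℕ) {e : ℂ}
    (he : α * K + 2 * K < e.re) :
    ∑ s ∈ (Finset.range (K + 1)).filter Even, ladderE α N K (e - α * s) (-s) =
      ∑ s ∈ (Finset.range (K + 1)).filter Even, ladderD α N K (e - (α + 1) * s) (-s) := by
  have hbound : ∀ s : ℤ, -K ≤ s → ∀ p : ℕ, p ≤ K →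
      α * ((K + s : ℤ) : ℝ) < (e + α * s - 2 * p : ℂ).re := by
    intro s _ p hp
    have hp' : (p : ℝ) ≤ K := by exact_mod_cast hp
    simp
    linarith
  refine sum_ladder_down (G := ladderG α N K) e K ?_ ?_ ?_
  · intro s hs _ p hp
    exact ladderE_eq_left hα N K (hbound s hs p hp)
  · intro s hs _ p hp
    have h := hbound s hs (p + 1) hp
    -- The positivity required by `ladderE_eq_right` follows from the convergence bound, since its
    -- lower end α(K + s) is nonnegative.
    have h0 : (0 : ℝ) ≤ α * ((K + s : ℤ) : ℝ) :=
      mul_nonneg hα.le (by exact_mod_cast (by omega : (0 : ℤ) ≤ K + s))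
    push_cast at h h0
    have := ladderE_eq_right hα N K (m := e + α * s - 2 * (p + 1)) (s := s) (h0.trans_lt h)
    rwa [show e + α * s - 2 * (p + 1) + 2 = e + α * s - 2 * p by ring] at this
  · intro m s hs
    rw [ladderG, coshIntegral_of_neg α _ (by omega), mul_zero, zero_div]

/-- All steps go upwards, so convergence at the starting point suffices. -/
theorem sum_ladder_pos {α : ℝ} (hα : 0 < α) (N K : ℕ) {e : ℂ} (he : α * K < e.re) :
    ∑ s ∈ (Finset.Icc 1 N).filter Even, ladderE α N K (e + α * s) s =
      ∑ s ∈ (Finset.Icc 1 N).filter Even, ladderD α N K (e + (α + 1) * s) s := by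
  have hbound : ∀ s : ℤ, ∀ p : ℕ, α * ((K + s : ℤ) : ℝ) < (e + α * s + 2 * p : ℂ).re := by
    intro s p
    have hp' : (0 : ℝ) ≤ p := p.cast_nonneg
    simp
    linarith
  refine sum_ladder_up (G := ladderG α N K) e N ?_ ?_ ?_
  · intro s hs _ p _
    have h := hbound s (p + 1)
    push_cast at h
    exact ladderE_eq_left hα N K (by push_cast; exact h)
  · intro s hs _ p _
    have h0 : (0 : ℝ) ≤ α * ((K + s : ℤ) : ℝ) :=
      mul_nonneg hα.le (by exact_mod_cast (by omega : (0 : ℤ) ≤ K + s))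
    have := ladderE_eq_right hα N K (m := e + α * s + 2 * p) (s := s) (h0.trans_lt (hbound s p))
    rwa [show e + α * s + 2 * p + 2 = e + α * s + 2 * (p + 1) by ring] at this
  · intro m s hs
    rw [ladderG, cosIntegral_of_neg α _ (by omega), zero_mul, zero_div]

/-! ### From a half-plane to the whole plane. -/

theorem meromorphic_extA {α : ℝ} (hα : 0 < α) (j : ℕ) (c : ℂ) :
    Meromorphic fun k => extA α j (k + c) :=
  Meromorphic.comp_entire (meromorphicContinuation_integralA hα j).1 (by fun_prop)

theorem meromorphic_extB {α : ℝ} (hα : 0 < α) (j : ℕ) (c : ℂ) :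
    Meromorphic fun k => extB α j (k + c) :=
  Meromorphic.comp_entire (meromorphicContinuation_integralB hα j).1 (by fun_prop)

theorem meromorphic_gamma_factor (α : ℝ) (c : ℂ) : Meromorphic fun k : ℂ =>
    (k + c + 1 / α) * Complex.Gamma (k + c) / Complex.Gamma (k + c + 1 + 2 / α) := by
  have h1 : Meromorphic fun k : ℂ => k + c + 1 / (α : ℂ) := fun k =>
    AnalyticAt.meromorphicAt (by fun_prop)
  have h2 : Meromorphic fun k : ℂ => Complex.Gamma (k + c) :=
    Meromorphic.comp_entire Meromorphic.Gamma (by fun_prop)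
  have h3 : Meromorphic fun k : ℂ => Complex.Gamma (k + c + 1 + 2 / α) :=
    Meromorphic.comp_entire Meromorphic.Gamma (by fun_prop)
  exact (h1.mul h2).div h3

theorem Meromorphic.fun_sum {ι : Type*} {S : Finset ι} {f : ι → ℂ → ℂ}
    (h : ∀ i ∈ S, Meromorphic (f i)) : Meromorphic fun z => ∑ i ∈ S, f i z := fun z =>
  MeromorphicAt.fun_sum fun i hi => h i hi z

theorem eventually_codiscrete_eq_of_re_gt {f g : ℂ → ℂ} (hf : Meromorphic f) (hg : Meromorphic g)
    (c : ℝ) (h : ∀ k : ℂ, c < k.re → f k = g k) : ∀ᶠ k in codiscrete ℂ, f k = g k := by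
  have hopen : IsOpen {k : ℂ | c < k.re} := isOpen_lt continuous_const Complex.continuous_re
  filter_upwards [eventually_codiscrete_eq_zero (hf.sub hg) hopen ⟨((c + 1 : ℝ) : ℂ), by simp⟩
    fun k hk => sub_eq_zero.2 (h k hk)] with k hk
  exact sub_eq_zero.1 hk

theorem codiscrete_identity_nonpos {α : ℝ} (hα : 0 < α) (N K : ℕ) : ∀ᶠ k : ℂ in codiscrete ℂ,
    ∑ s ∈ (Finset.range (K + 1)).filter Even, extB α (N + s) (k + (K - s)) *
        ((k + (K - s) + 1 / α) * Complex.Gamma (k + (K - s)) /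
          Complex.Gamma (k + (K - s) + 1 + 2 / α)) * extA α (K - s) (k + 2 / α) =
      ∑ q ∈ (Finset.range (K + 1)).filter Even,
        extB α (N + q) (k + (K - q - q / α)) * extA α (K - q) (k + -(q / α)) := by
  have hα0 : (α : ℂ) ≠ 0 := by exact_mod_cast hα.ne'
  refine eventually_codiscrete_eq_of_re_gt
    (Meromorphic.fun_sum fun s _ => ((meromorphic_extB hα _ _).mul
      (meromorphic_gamma_factor α _)).mul (meromorphic_extA hα _ _))
    (Meromorphic.fun_sum fun q _ => (meromorphic_extB hα _ _).mul (meromorphic_extA hα _ _))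
    -- In the variable e = α(k + K) this is the bound αK + 2K < Re e; it also keeps Re(k - s/α)
    -- positive for s ≤ K, as needed for the integral formula of A on the right.
    (2 * K / α) fun k hk => ?_
  have hk' : 2 * K < α * k.re := by rwa [div_lt_iff₀' hα] at hk
  have hK0 : (0 : ℝ) ≤ K := K.cast_nonneg
  have hlad := sum_ladder_nonpos hα N K (e := α * (k + K)) (by simp; nlinarith)
  have hk0 : 0 < k.re := lt_of_le_of_lt (by positivity) hk
  have hL : ∀ s ∈ (Finset.range (K + 1)).filter Even, _ = _ := fun s hs => by
    have hs' : s ≤ K := by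
      have := (Finset.mem_filter.1 hs).1
      rw [Finset.mem_range] at this; omega
    exact left_summand_eq hα N K (i := K - s) (j := N + s) (s := -s) (by omega)
      (by push_cast; ring) (k := k) (m := k + (K - s)) (e := α * (k + K) - α * s)
      (by push_cast [hs']; ring) (by ring) hk0
  have hR : ∀ s ∈ (Finset.range (K + 1)).filter Even, _ = _ := fun s hs => by
    have hs' : s ≤ K := by
      have := (Finset.mem_filter.1 hs).1
      rw [Finset.mem_range] at this; omega
    have hsK : (s : ℝ) ≤ K := by exact_mod_cast hs'
    exact right_summand_eq hα N K (i := K - s) (j := N + s) (s := -s) (by omega)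
      (by push_cast; ring) (k := k + -(s / α)) (m := k + (K - s - s / α))
      (e := α * (k + K) - (α + 1) * s) (by push_cast [hs']; ring) (by field_simp; ring) (by
        rw [show (k + -(s / α) : ℂ) = k + ((-(s / α) : ℝ) : ℂ) by push_cast; rfl, Complex.add_re,
          Complex.ofReal_re]
        have : (s : ℝ) / α ≤ 2 * K / α := by gcongr; linarith
        linarith)
  rw [Finset.sum_congr rfl hL, Finset.sum_congr rfl hR, ← Finset.mul_sum, ← Finset.mul_sum, hlad]

theorem codiscrete_identity_pos {α : ℝ} (hα : 0 < α) (N K : ℕ) : ∀ᶠ k : ℂ in codiscrete ℂ,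
    ∑ s ∈ (Finset.Icc 1 N).filter Even, extB α (N - s) (k + (K + s)) *
        ((k + (K + s) + 1 / α) * Complex.Gamma (k + (K + s)) /
          Complex.Gamma (k + (K + s) + 1 + 2 / α)) * extA α (K + s) (k + 2 / α) =
      ∑ q ∈ (Finset.Icc 1 N).filter Even,
        extB α (N - q) (k + (K + q + q / α)) * extA α (K + q) (k + q / α) := by
  have hα0 : (α : ℂ) ≠ 0 := by exact_mod_cast hα.ne'
  refine eventually_codiscrete_eq_of_re_gt
    (Meromorphic.fun_sum fun s _ => ((meromorphic_extB hα _ _).mul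
      (meromorphic_gamma_factor α _)).mul (meromorphic_extA hα _ _))
    (Meromorphic.fun_sum fun q _ => (meromorphic_extB hα _ _).mul (meromorphic_extA hα _ _))
    0 fun k hk => ?_
  have hlad := sum_ladder_pos hα N K (e := α * (k + K)) (by simp; nlinarith)
  have hL : ∀ s ∈ (Finset.Icc 1 N).filter Even, _ = _ := fun s hs => by
    have hs' : s ≤ N := (Finset.mem_Icc.1 (Finset.mem_filter.1 hs).1).2
    exact left_summand_eq hα N K (i := K + s) (j := N - s) (s := s) (by omega) (by omega)
      (k := k) (m := k + (K + s)) (e := α * (k + K) + α * s) (by push_cast; ring) (by ring) hk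
  have hR : ∀ s ∈ (Finset.Icc 1 N).filter Even, _ = _ := fun s hs => by
    have hs' : s ≤ N := (Finset.mem_Icc.1 (Finset.mem_filter.1 hs).1).2
    exact right_summand_eq hα N K (i := K + s) (j := N - s) (s := s) (by omega)
      (by omega) (k := k + s / α) (m := k + (K + s + s / α))
      (e := α * (k + K) + (α + 1) * s) (by push_cast; ring) (by field_simp; ring) (by
        rw [show (k + s / α : ℂ) = k + ((s / α : ℝ) : ℂ) by push_cast; rfl, Complex.add_re,
          Complex.ofReal_re]
        have : (0 : ℝ) ≤ s / α := by positivity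
        linarith)
  rw [Finset.sum_congr rfl hL, Finset.sum_congr rfl hR, ← Finset.mul_sum, ← Finset.mul_sum]
  exact congrArg _ hlad

end BetaPolytope

end

theorem theorem2p4 (α : ℝ) (hα : 0 < α) :
    (∀ j : ℕ, Meromorphic (fun κ : ℂ => BetaPolytope.A α (κ + j) κ) ∧
      ∀ κ : ℂ, 0 < κ.re → BetaPolytope.A α (κ + j) κ = BetaPolytope.integralA α j κ) ∧
    (∀ j : ℕ, Meromorphic (fun κ : ℂ => BetaPolytope.B α (κ + j) κ) ∧
      ∀ κ : ℂ, -(1 / α) < κ.re → BetaPolytope.B α (κ + j) κ = BetaPolytope.integralB α j κ) ∧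
    ∀ N K : ℕ, ∀ᶠ k : ℂ in Filter.codiscrete ℂ, ∀ n d : ℂ, n - d = N → d - k = K →
      (∑ s ∈ (Finset.range (K + 1)).filter Even,
          BetaPolytope.B α n (d - s) *
            ((d - s + 1 / α) * Complex.Gamma (d - s) / Complex.Gamma (d - s + 1 + 2 / α)) *
            BetaPolytope.A α (d - s + 2 / α) (k + 2 / α)
        = ∑ q ∈ (Finset.range (K + 1)).filter Even,
          BetaPolytope.B α (n - q / α) (d - q - q / α) *
            BetaPolytope.A α (d - q - q / α) (k - q / α)) ∧
      (∑ s ∈ (Finset.Icc 1 N).filter Even,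
          BetaPolytope.B α n (d + s) *
            ((d + s + 1 / α) * Complex.Gamma (d + s) / Complex.Gamma (d + s + 1 + 2 / α)) *
            BetaPolytope.A α (d + s + 2 / α) (k + 2 / α)
        = ∑ q ∈ (Finset.Icc 1 N).filter Even,
          BetaPolytope.B α (n + q / α) (d + q + q / α) *
            BetaPolytope.A α (d + q + q / α) (k + q / α)) := by
  refine ⟨fun j => ?_, fun j => ?_, fun N K => ?_⟩
  · have h : ∀ κ : ℂ, BetaPolytope.A α (κ + j) κ = BetaPolytope.extA α j κ := fun κ =>
      BetaPolytope.A_eq_extA α (by ring)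
    simp only [h]
    exact ⟨(BetaPolytope.meromorphicContinuation_integralA hα j).1, fun κ hκ =>
      (BetaPolytope.meromorphicContinuation_integralA hα j).2 hκ⟩
  · have h : ∀ κ : ℂ, BetaPolytope.B α (κ + j) κ = BetaPolytope.extB α j κ := fun κ =>
      BetaPolytope.B_eq_extB α (by ring)
    simp only [h]
    exact ⟨(BetaPolytope.meromorphicContinuation_integralB hα j).1, fun κ hκ =>
      (BetaPolytope.meromorphicContinuation_integralB hα j).2 hκ⟩
  · filter_upwards [BetaPolytope.codiscrete_identity_nonpos hα N K,
      BetaPolytope.codiscrete_identity_pos hα N K] with k hk₁ hk₂ n d hn hd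
    -- For given k the integers N and K determine d and n, so every A and B becomes a function of k
    -- alone with a fixed index difference.
    obtain rfl : d = k + K := by linear_combination hd
    obtain rfl : n = k + K + N := by linear_combination hn
    constructor
    · convert hk₁ using 2 with s hs s hs
      all_goals
        have hs' : s ≤ K := by
          have := (Finset.mem_filter.1 hs).1
          rw [Finset.mem_range] at this
          omega
      · rw [BetaPolytope.B_eq_extB α (j := N + s) (by push_cast; ring),
          BetaPolytope.A_eq_extA α (j := K - s) (by push_cast [hs']; ring), add_sub_assoc]
      · rw [BetaPolytope.B_eq_extB α (j := N + s) (by push_cast; ring),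
          BetaPolytope.A_eq_extA α (j := K - s) (by push_cast [hs']; ring)]
        congr 2
        ring
    · convert hk₂ using 2 with s hs s hs
      all_goals
        have hs' : s ≤ N := (Finset.mem_Icc.1 (Finset.mem_filter.1 hs).1).2
      · rw [BetaPolytope.B_eq_extB α (j := N - s) (by push_cast [hs']; ring),
          BetaPolytope.A_eq_extA α (j := K + s) (by push_cast; ring), add_assoc k]
      · rw [BetaPolytope.B_eq_extB α (j := N - s) (by push_cast [hs']; ring),
          BetaPolytope.A_eq_extA α (j := K + s) (by push_cast; ring)]
        congr 2; ring
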